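/- Let $\mathbf H_1=\{\tau=x+iy\in\mathbb C : y>0\}$ be the upper half plane, and write $z=u+iv$ for the coordinate on $\mathbb C$ ($x,y,u,v$ real). The Jacobi group $G^J=Sp(1,\mathbb R)\ltimes H_{\mathbb R}^{(1,1)}$ consists of the pairs $(M,(\lambda,\mu,\kappa))$ with $M\in Sp(1,\mathbb R)=SL(2,\mathbb R)$ and $\lambda,\mu,\kappa\in\mathbb R$, with the multiplication $$(M_0,(\lambda_0,\mu_0,\kappa_0))\cdot(M,(\lambda,\mu,\kappa))=\big(M_0M,(\tilde\lambda_0+\lambda,\ \tilde\mu_0+\mu,\ \kappa_0+\kappa+\tilde\lambda_0\mu-\tilde\mu_0\lambda)\big),\qquad(\tilde\lambda_0,\tilde\mu_0)=(\lambda_0,\mu_0)M,$$ and it acts on $\mathbf H_1\times\mathbb C$ by $$\left(\begin{pmatrix}a&b\\c&d\end{pmatrix},(\lambda,\mu,\kappa)\right)\cdot(\tau,z)=\left(\frac{a\tau+b}{c\tau+d},\ \frac{z+\lambda\tau+\mu}{c\tau+d}\right).$$ Let $\mathbb D(\mathbf H_1\times\mathbb C)$ be the complex algebra of all differential operators $P$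 (of finite order, with smooth complex-valued coefficients, acting on $C^\infty(\mathbf H_1\times\mathbb C,\mathbb C)$) that are invariant under $G^J$, that is, $P(f\circ g)=(Pf)\circ g$ for all $g\in G^J$ and all smooth $f$. **Theorem.** The $\mathbb C$-algebra (with unit) $\mathbb D(\mathbf H_1\times\mathbb C)$ is generated by the following differential operators: $$D=y^2\left(\frac{\partial^2}{\partial x^2}+\frac{\partial^2}{\partial y^2}\right)+v^2\left(\frac{\partial^2}{\partial u^2}+\frac{\partial^2}{\partial v^2}\right)+2yv\left(\frac{\partial^2}{\partial x\partial u}+\frac{\partial^2}{\partial y\partial v}\right),$$ $$\Psi=y\left(\frac{\partial^2}{\partial u^2}+\frac{\partial^2}{\partial v^2}\right),$$ $$D_1=2y^2\frac{\partial^3}{\partial x\partial u\partial v}-y^2\frac{\partial}{\partial y}\left(\frac{\partial^2}{\partial u^2}-\frac{\partial^2}{\partial v^2}\right)+\left(v\frac{\partial}{\partial v}+1\right)\Psi,$$ $$D_2=y^2\frac{\partial}{\partial x}\left(\frac{\partial^2}{\partial v^2}-\frac{\partial^2}{\partial u^2}\right)-2y^2\frac{\partial^3}{\partial y\partial u\partial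 v}-v\frac{\partial}{\partial u}\Psi.$$ Moreover, $$D\Psi-\Psi D=2y^2\frac{\partial}{\partial y}\left(\frac{\partial^2}{\partial u^2}-\frac{\partial^2}{\partial v^2}\right)-4y^2\frac{\partial^3}{\partial x\partial u\partial v}-2\left(v\frac{\partial}{\partial v}\Psi+\Psi\right).$$ -/

import Mathlib

open scoped ContDiff UpperHalfPlane MatrixGroups

namespace SiegelJacobi

/-! ### The Jacobi group and its action on `ℍ × ℂ` -/

/-- The Jacobi group `G^J = Sp(1, ℝ) ⋉ H_ℝ^{(1,1)}`: a matrix `M` in `Sp(1, ℝ) = SL(2, ℝ)` and an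
element `(λ, μ, κ)` of the Heisenberg group. -/
@[ext]
structure JacobiGroup where
  mat : SL(2, ℝ)
  lam : ℝ
  mu : ℝ
  kappa : ℝ

namespace JacobiGroup

/-- First entry of the row vector `(λ, μ) M`. -/
def lamTilde (g : JacobiGroup) (M : SL(2, ℝ)) : ℝ := g.lam * M 0 0 + g.mu * M 1 0

/-- Second entry of the row vector `(λ, μ) M`. -/
def muTilde (g : JacobiGroup) (M : SL(2, ℝ)) : ℝ := g.lam * M 0 1 + g.mu * M 1 1

instance : Mul JacobiGroup where
  mul g h :=
    { mat := g.mat * h.mat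
      lam := g.lamTilde h.mat + h.lam
      mu := g.muTilde h.mat + h.mu
      kappa := g.kappa + h.kappa + g.lamTilde h.mat * h.mu - g.muTilde h.mat * h.lam }

instance : One JacobiGroup where
  one := { mat := 1, lam := 0, mu := 0, kappa := 0 }

instance : Inv JacobiGroup where
  inv g :=
    { mat := g.mat⁻¹
      lam := -g.lamTilde g.mat⁻¹
      mu := -g.muTilde g.mat⁻¹
      kappa := -g.kappa }

theorem mul_mat (g h : JacobiGroup) : (g * h).mat = g.mat * h.mat := rfl
theorem mul_lam (g h : JacobiGroup) : (g * h).lam = g.lamTilde h.mat + h.lam := rfl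
theorem mul_mu (g h : JacobiGroup) : (g * h).mu = g.muTilde h.mat + h.mu := rfl
theorem mul_kappa (g h : JacobiGroup) : (g * h).kappa =
    g.kappa + h.kappa + g.lamTilde h.mat * h.mu - g.muTilde h.mat * h.lam := rfl
theorem one_mat : (1 : JacobiGroup).mat = 1 := rfl
theorem one_lam : (1 : JacobiGroup).lam = 0 := rfl
theorem one_mu : (1 : JacobiGroup).mu = 0 := rfl
theorem one_kappa : (1 : JacobiGroup).kappa = 0 := rfl
theorem inv_mat (g : JacobiGroup) : (g⁻¹).mat = g.mat⁻¹ := rfl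
theorem inv_lam (g : JacobiGroup) : (g⁻¹).lam = -g.lamTilde g.mat⁻¹ := rfl
theorem inv_mu (g : JacobiGroup) : (g⁻¹).mu = -g.muTilde g.mat⁻¹ := rfl
theorem inv_kappa (g : JacobiGroup) : (g⁻¹).kappa = -g.kappa := rfl

theorem det_eq (M : SL(2, ℝ)) : M 0 0 * M 1 1 - M 0 1 * M 1 0 = 1 := by
  have h := M.det_coe
  rwa [Matrix.det_fin_two] at h

instance : Group JacobiGroup :=
  Group.ofLeftAxioms
    (by
      intro g h k
      have hd := det_eq k.mat
      ext1
      · simp only [mul_mat, mul_assoc]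
      · simp only [mul_mat, mul_lam, mul_mu, lamTilde, muTilde, Matrix.SpecialLinearGroup.coe_mul,
          Matrix.mul_apply, Fin.sum_univ_two]
        ring
      · simp only [mul_mat, mul_lam, mul_mu, lamTilde, muTilde, Matrix.SpecialLinearGroup.coe_mul,
          Matrix.mul_apply, Fin.sum_univ_two]
        ring
      · simp only [mul_mat, mul_lam, mul_mu, mul_kappa, lamTilde, muTilde,
          Matrix.SpecialLinearGroup.coe_mul, Matrix.mul_apply, Fin.sum_univ_two]
        linear_combination (-(g.lam * h.mat 0 0 + g.mu * h.mat 1 0) * h.mu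
          + (g.lam * h.mat 0 1 + g.mu * h.mat 1 1) * h.lam) * hd)
    (by
      intro g
      ext1 <;> simp [mul_mat, mul_lam, mul_mu, mul_kappa, one_mat, one_lam, one_mu, one_kappa,
        lamTilde, muTilde])
    (by
      intro g
      have hd := det_eq g.mat
      ext1
      · simp [mul_mat, inv_mat, one_mat]
      · simp only [mul_lam, one_lam, lamTilde, inv_lam, inv_mu, muTilde,
          Matrix.SpecialLinearGroup.coe_inv, Matrix.adjugate_fin_two]
        simp
        linear_combination (-g.lam) * hd
      · simp only [mul_mu, one_mu, lamTilde, inv_lam, inv_mu, muTilde,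
          Matrix.SpecialLinearGroup.coe_inv, Matrix.adjugate_fin_two]
        simp
        linear_combination (-g.mu) * hd
      · simp only [mul_kappa, one_kappa, lamTilde, inv_lam, inv_mu, inv_kappa, muTilde,
          Matrix.SpecialLinearGroup.coe_inv, Matrix.adjugate_fin_two]
        simp
        ring)

/-- The factor of automorphy `c τ + d`. -/
noncomputable def autFactor (g : JacobiGroup) (τ : ℂ) : ℂ := (g.mat 1 0 : ℂ) * τ + (g.mat 1 1 : ℂ)

/-- The action `(M, (λ, μ, κ)) · (τ, z) = ((aτ + b)/(cτ + d), (z + λτ + μ)/(cτ + d))`; the first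
component is Mathlib's Möbius action of `SL(2, ℝ)` on `ℍ`. -/
noncomputable instance : SMul JacobiGroup (ℍ × ℂ) where
  smul g p := (g.mat • p.1, (p.2 + (g.lam : ℂ) * (p.1 : ℂ) + (g.mu : ℂ)) / g.autFactor p.1)

theorem smul_def (g : JacobiGroup) (p : ℍ × ℂ) :
    g • p = (g.mat • p.1, (p.2 + (g.lam : ℂ) * (p.1 : ℂ) + (g.mu : ℂ)) / g.autFactor p.1) := rfl

theorem autFactor_ne_zero (g : JacobiGroup) {τ : ℂ} (hτ : 0 < τ.im) : g.autFactor τ ≠ 0 := by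
  intro h
  have hd := det_eq g.mat
  have him : g.mat 1 0 * τ.im = 0 := by simpa [autFactor] using congrArg Complex.im h
  have hre : g.mat 1 0 * τ.re + g.mat 1 1 = 0 := by simpa [autFactor] using congrArg Complex.re h
  have hc : g.mat 1 0 = 0 := by
    rcases mul_eq_zero.mp him with h | h
    · exact h
    · exact absurd h hτ.ne'
  rw [hc] at hre hd
  have hdd : g.mat 1 1 = 0 := by simpa using hre
  simp [hdd] at hd

theorem coe_mat_smul (g : JacobiGroup) (τ : ℍ) :
    ((g.mat • τ : ℍ) : ℂ) = ((g.mat 0 0 : ℂ) * τ + (g.mat 0 1 : ℂ)) / g.autFactor τ := by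
  simp [UpperHalfPlane.coe_specialLinearGroup_apply, autFactor]

noncomputable instance : MulAction JacobiGroup (ℍ × ℂ) where
  one_smul p := by
    rw [smul_def]
    ext1 <;> simp [one_mat, one_lam, one_mu, autFactor]
  mul_smul g h p := by
    have hh := h.autFactor_ne_zero p.1.im_pos
    have hg := g.autFactor_ne_zero (h.mat • p.1).im_pos
    have key : (g * h).autFactor p.1 = g.autFactor (h.mat • p.1 : ℍ) * h.autFactor p.1 := by
      rw [autFactor, autFactor, coe_mat_smul]
      field_simp
      simp only [autFactor, mul_mat, Matrix.SpecialLinearGroup.coe_mul, Matrix.mul_apply,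
        Fin.sum_univ_two]
      push_cast
      ring
    simp only [smul_def]
    ext1
    · simp [mul_mat, mul_smul]
    · simp only [key]
      rw [div_eq_div_iff (mul_ne_zero hg hh) hg, coe_mat_smul]
      field_simp
      simp only [autFactor, mul_lam, mul_mu, lamTilde, muTilde]
      push_cast
      ring

end JacobiGroup

/-! ### Smooth functions on `ℍ × ℂ` -/

/-- The open subset `{(τ, z) | Im τ > 0}` of `ℂ × ℂ`, that is `ℍ × ℂ`. -/
def domain : Set (ℂ × ℂ) := {p | 0 < p.1.im}

theorem isOpen_domain : IsOpen domain :=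
  isOpen_lt continuous_const (Complex.continuous_im.comp continuous_fst)

/-- A function on `ℍ × ℂ` read on `ℂ × ℂ`; only its values on `domain` matter, and there it is
`f (τ, z)`. -/
noncomputable def extend (f : ℍ × ℂ → ℂ) (p : ℂ × ℂ) : ℂ := f (UpperHalfPlane.ofComplex p.1, p.2)

theorem extend_coe (f : ℍ × ℂ → ℂ) (p : ℍ × ℂ) : extend f ((p.1 : ℂ), p.2) = f p := by
  simp [extend, UpperHalfPlane.ofComplex_apply]

/-- `C^∞(ℍ × ℂ)`: the complex-valued functions on `ℍ × ℂ` that are smooth in the real sense. -/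
def smoothFunctions : Subalgebra ℂ (ℍ × ℂ → ℂ) where
  carrier := {f | ContDiffOn ℝ ∞ (extend f) domain}
  mul_mem' hf hg := ContDiffOn.mul hf hg
  add_mem' hf hg := ContDiffOn.add hf hg
  algebraMap_mem' _ := contDiffOn_const

theorem mem_smoothFunctions {f : ℍ × ℂ → ℂ} :
    f ∈ smoothFunctions ↔ ContDiffOn ℝ ∞ (extend f) domain := Iff.rfl

theorem mem_smoothFunctions_of_eqOn {f : ℍ × ℂ → ℂ} {F : ℂ × ℂ → ℂ}
    (hF : ContDiffOn ℝ ∞ F domain) (h : ∀ p : ℍ × ℂ, f p = F ((p.1 : ℂ), p.2)) :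
    f ∈ smoothFunctions := by
  refine ContDiffOn.congr hF fun p hp => ?_
  rw [extend, h, UpperHalfPlane.ofComplex_apply_of_im_pos hp]

/-- The coordinate function `y = Im τ`. -/
noncomputable def coordY : smoothFunctions :=
  ⟨fun p => ((p.1.im : ℝ) : ℂ),
    mem_smoothFunctions_of_eqOn (F := fun p => ((Complex.imCLM p.1 : ℝ) : ℂ))
      ((Complex.ofRealCLM.contDiff.comp
        (Complex.imCLM.contDiff.comp contDiff_fst)).contDiffOn)
      fun _ => rfl⟩

/-- The coordinate function `v = Im z`. -/
noncomputable def coordV : smoothFunctions :=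
  ⟨fun p => ((p.2.im : ℝ) : ℂ),
    mem_smoothFunctions_of_eqOn (F := fun p => ((Complex.imCLM p.2 : ℝ) : ℂ))
      ((Complex.ofRealCLM.contDiff.comp
        (Complex.imCLM.contDiff.comp contDiff_snd)).contDiffOn)
      fun _ => rfl⟩

/-! ### Differential operators -/

/-- The derivative of smooth functions in the real direction `w` of `ℂ × ℂ`. -/
noncomputable def dirDeriv (w : ℂ × ℂ) : Module.End ℂ smoothFunctions where
  toFun f := ⟨fun p => fderiv ℝ (extend f) ((p.1 : ℂ), p.2) w,
    mem_smoothFunctions_of_eqOn (F := fun p => fderiv ℝ (extend f) p w)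
      ((f.2.fderiv_of_isOpen (m := ∞) isOpen_domain le_rfl).clm_apply contDiffOn_const)
      fun _ => rfl⟩
  map_add' f g := by
    ext p
    have hp : ((p.1 : ℂ), p.2) ∈ domain := p.1.im_pos
    have hf := ((mem_smoothFunctions.mp f.2).differentiableOn (by simp)).differentiableAt
      (isOpen_domain.mem_nhds hp)
    have hg := ((mem_smoothFunctions.mp g.2).differentiableOn (by simp)).differentiableAt
      (isOpen_domain.mem_nhds hp)
    exact congrArg (fun L => L w) (fderiv_add hf hg)
  map_smul' c f := by
    ext p
    have hp : ((p.1 : ℂ), p.2) ∈ domain := p.1.im_pos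
    have hf := ((mem_smoothFunctions.mp f.2).differentiableOn (by simp)).differentiableAt
      (isOpen_domain.mem_nhds hp)
    exact congrArg (fun L => L w) (fderiv_const_smul hf c)

/-- `∂/∂x`, where `τ = x + i y`. -/
noncomputable def dx : Module.End ℂ smoothFunctions := dirDeriv (1, 0)

/-- `∂/∂y`, where `τ = x + i y`. -/
noncomputable def dy : Module.End ℂ smoothFunctions := dirDeriv (Complex.I, 0)

/-- `∂/∂u`, where `z = u + i v`. -/
noncomputable def du : Module.End ℂ smoothFunctions := dirDeriv (0, 1)

/-- `∂/∂v`, where `z = u + i v`. -/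
noncomputable def dv : Module.End ℂ smoothFunctions := dirDeriv (0, Complex.I)

/-- The operator of multiplication by a smooth function. -/
noncomputable def mulOp (a : smoothFunctions) : Module.End ℂ smoothFunctions :=
  LinearMap.mulLeft ℂ a

/-- The iterated partial derivative with multi-index `α`, in the coordinates `x, y, u, v`. -/
noncomputable def partialDeriv (α : Fin 4 → ℕ) : Module.End ℂ smoothFunctions :=
  dx ^ α 0 * dy ^ α 1 * du ^ α 2 * dv ^ α 3

/-- `P` is a (linear, finite order) differential operator on `ℍ × ℂ` with smooth complex-valued
coefficients: `P = ∑_α a_α ∂^α`, a finite sum. -/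
def IsDifferentialOperator (P : Module.End ℂ smoothFunctions) : Prop :=
  ∃ (s : Finset (Fin 4 → ℕ)) (a : (Fin 4 → ℕ) → smoothFunctions),
    P = ∑ α ∈ s, mulOp (a α) * partialDeriv α

/-- The pull-back `f ↦ (p ↦ f (g · p))` of smooth functions under an element of the Jacobi
group. -/
noncomputable def pullback (g : JacobiGroup) : Module.End ℂ smoothFunctions where
  toFun f := ⟨fun p => (f : ℍ × ℂ → ℂ) (g • p), by
    let G : ℂ × ℂ → ℂ × ℂ := fun p =>
      (((g.mat 0 0 : ℂ) * p.1 + (g.mat 0 1 : ℂ)) / g.autFactor p.1,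
        (p.2 + (g.lam : ℂ) * p.1 + (g.mu : ℂ)) / g.autFactor p.1)
    have hG' : ∀ p : ℍ × ℂ,
        G ((p.1 : ℂ), p.2) = (((g • p).1 : ℂ), (g • p).2) := fun p => by
      simp only [G, JacobiGroup.smul_def, JacobiGroup.coe_mat_smul]
    have hmap : Set.MapsTo G domain domain := fun p hp => by
      have := hG' (⟨p.1, hp⟩, p.2)
      simp only at this
      change 0 < (G (p.1, p.2)).1.im
      exact this ▸ (g • ((⟨p.1, hp⟩, p.2) : ℍ × ℂ)).1.im_pos
    have h1 : ContDiffOn ℝ ∞ (fun p : ℂ × ℂ => p.1) domain := contDiff_fst.contDiffOn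
    have h2 : ContDiffOn ℝ ∞ (fun p : ℂ × ℂ => p.2) domain := contDiff_snd.contDiffOn
    have hj : ContDiffOn ℝ ∞ (fun p : ℂ × ℂ => g.autFactor p.1) domain :=
      (contDiffOn_const.mul h1).add contDiffOn_const
    have hj0 : ∀ p ∈ domain, g.autFactor p.1 ≠ 0 := fun p hp => g.autFactor_ne_zero hp
    have hG : ContDiffOn ℝ ∞ G domain := by
      simp only [G, div_eq_mul_inv]
      exact (((contDiffOn_const.mul h1).add contDiffOn_const).mul (hj.inv hj0)).prodMk
        (((h2.add (contDiffOn_const.mul h1)).add contDiffOn_const).mul (hj.inv hj0))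
    refine mem_smoothFunctions_of_eqOn ((mem_smoothFunctions.mp f.2).comp hG hmap) fun p => ?_
    rw [Function.comp_apply, hG', extend_coe]⟩
  map_add' _ _ := rfl
  map_smul' _ _ := rfl

/-- `P` is invariant under the action of the Jacobi group: `P (f ∘ g) = (P f) ∘ g` for all `g` in
`G^J` and all smooth `f`. -/
def IsInvariant (P : Module.End ℂ smoothFunctions) : Prop :=
  ∀ (g : JacobiGroup) (f : smoothFunctions), P (pullback g f) = pullback g (P f)

/-- The set `𝔻(ℍ × ℂ)` of all differential operators on `ℍ × ℂ` that are invariant under the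
Jacobi group. -/
def invariantDiffOps : Set (Module.End ℂ smoothFunctions) :=
  {P | IsDifferentialOperator P ∧ IsInvariant P}

/-! ### The explicit operators (products are compositions) -/

/-- `y² (∂²/∂x² + ∂²/∂y²) + v² (∂²/∂u² + ∂²/∂v²) + 2 y v (∂²/∂x∂u + ∂²/∂y∂v)`. -/
noncomputable def opD : Module.End ℂ smoothFunctions :=
  mulOp (coordY ^ 2) * (dx ^ 2 + dy ^ 2) + mulOp (coordV ^ 2) * (du ^ 2 + dv ^ 2)
    + mulOp (2 * coordY * coordV) * (dx * du + dy * dv)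

/-- `y (∂²/∂u² + ∂²/∂v²)`. -/
noncomputable def opPsi : Module.End ℂ smoothFunctions :=
  mulOp coordY * (du ^ 2 + dv ^ 2)

/-- `2 y² ∂³/∂x∂u∂v - y² ∂/∂y (∂²/∂u² - ∂²/∂v²) + (v ∂/∂v + 1) Ψ`. -/
noncomputable def opD1 : Module.End ℂ smoothFunctions :=
  mulOp (2 * coordY ^ 2) * (dx * du * dv) - mulOp (coordY ^ 2) * (dy * (du ^ 2 - dv ^ 2))
    + (mulOp coordV * dv + 1) * opPsi

/-- `y² ∂/∂x (∂²/∂v² - ∂²/∂u²) - 2 y² ∂³/∂y∂u∂v - v ∂/∂u Ψ`. -/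
noncomputable def opD2 : Module.End ℂ smoothFunctions :=
  mulOp (coordY ^ 2) * (dx * (dv ^ 2 - du ^ 2)) - mulOp (2 * coordY ^ 2) * (dy * du * dv)
    - mulOp coordV * du * opPsi

end SiegelJacobi

/-!
Write `N = ∂/∂τ + (v / y) ∂/∂z` (`horiz`). In the coordinates `τ, p, q` with `z = p τ + q` and
`p, q` real it is `∂/∂τ` at constant `p, q`, and the Jacobi group acts on `(p, q)` by constant
affine maps; hence under pull-back by `g`, with automorphy factor `J = c τ + d`, the operators `N`
and `∂/∂z` are multiplied by `J⁻²` and `J⁻¹`, while `y` is multiplied by `|J|⁻²`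
(`horiz_pullback`, `dz_pullback`, `pullback_coordY`). The operators `y² N N̄`, `y ∂/∂z ∂/∂z̄`,
`y² N (∂/∂z̄)²` and `y² N̄ (∂/∂z)²` are therefore invariant, and they span the same space as
`D, Ψ, D₁, D₂` (`opD_eq`, `opPsi_eq`, `opD1_eq`, `opD2_eq`, `generated_mem`).

Conversely, the action is transitive, so an invariant operator `P` is determined by the functional
`f ↦ (P f)(i, 0)` (`eq_zero_of_eval_eq_zero`). Suppose that this functional is given by derivatives
of order `≤ n`. Its coefficient at `∂^α`, for `|α| = n` and `∂` the Wirtinger derivatives, is read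
off by testing against the monomials of degree `n` in the Cayley coordinates
`(τ - i) / (τ + i)`, `z / (τ + i)` and their conjugates. These are eigenfunctions of the rotations,
which fix `(i, 0)`; so the coefficient vanishes unless `2 α₀ + α₂ = 2 α₁ + α₃`
(`eval_testFun_eq_zero`). For these `α`, a product of powers of the four generators has leading
term `∂^α` at `(i, 0)` (`exists_hasLeading`), because leading terms at a point are multiplicative
(`Frame.HasLeading.mul`). Subtracting such products lowers the order of the functional, and
induction on the order concludes (`Frame.mem_of_leading`).

The commutator formula is a computation with the Leibniz rule (`commutator_eq`).
-/

namespace SiegelJacobi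

/-! ### Operators generated by commuting derivations, filtered by order -/

/-- Four pairwise commuting `ℂ`-linear derivations of a commutative `ℂ`-algebra, viewed as
endomorphisms so that they can be composed. -/
structure Frame (R : Type*) [CommRing R] [Algebra ℂ R] where
  op : Fin 4 → Module.End ℂ R
  leibniz : ∀ i a b, op i (a * b) = a * op i b + b * op i a
  commute : ∀ i j, Commute (op i) (op j)

namespace Frame

/-- The test function `∏ i, t i ^ β i`. -/
def testFun {R : Type*} [CommRing R] (t : Fin 4 → R) (β : Fin 4 → ℕ) : R := ∏ i, t i ^ β i

theorem testFun_add_single {R : Type*} [CommRing R] (t : Fin 4 → R) (β : Fin 4 → ℕ) (i : Fin 4) :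
    testFun t (β + Pi.single i 1) = t i * testFun t β := by
  simp only [testFun, Pi.add_apply, pow_add, Finset.prod_mul_distrib]
  rw [mul_comm]
  congr 1
  rw [Finset.prod_eq_single i (by intro j _ hj; simp [hj]) (by simp)]
  simp

variable {R : Type*} [CommRing R] [Algebra ℂ R] (F : Frame R)

/-- The monomial of multi-index `α` in the derivations of the frame. -/
noncomputable def mono (α : Fin 4 → ℕ) : Module.End ℂ R :=
  F.op 0 ^ α 0 * F.op 1 ^ α 1 * F.op 2 ^ α 2 * F.op 3 ^ α 3

/-- The order of a multi-index. -/
def deg (α : Fin 4 → ℕ) : ℕ := ∑ i, α i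

theorem deg_add (α β : Fin 4 → ℕ) : deg (α + β) = deg α + deg β := by
  simp [deg, Finset.sum_add_distrib]

theorem deg_single (i : Fin 4) : deg (Pi.single i 1) = 1 := by
  simp [deg]

theorem deg_zero : deg 0 = 0 := by simp [deg]

theorem mono_zero : F.mono 0 = 1 := by simp [mono]

theorem op_mul_mono (i : Fin 4) (α : Fin 4 → ℕ) :
    F.op i * F.mono α = F.mono (α + Pi.single i 1) := by
  have h (i j : Fin 4) (n : ℕ) : F.op i * F.op j ^ n = F.op j ^ n * F.op i :=
    ((F.commute i j).pow_right n).eq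
  have h' (i j : Fin 4) (n : ℕ) (P : Module.End ℂ R) :
      F.op i * (F.op j ^ n * P) = F.op j ^ n * (F.op i * P) := by
    rw [← mul_assoc, h, mul_assoc]
  fin_cases i
  · simp [mono, pow_succ', mul_assoc]
  · simp [mono, pow_succ', mul_assoc, h' 1 0]
  · simp [mono, pow_succ', mul_assoc, h' 2 0, h' 2 1]
  · simp [mono, pow_succ', mul_assoc, h' 3 0, h' 3 1, h' 3 2]

theorem mono_single (i : Fin 4) : F.mono (Pi.single i 1) = F.op i := by
  simpa [mono_zero] using (F.op_mul_mono i 0).symm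

theorem exists_eq_add_single {α : Fin 4 → ℕ} {n : ℕ} (h : deg α = n + 1) :
    ∃ i β, α = β + Pi.single i 1 ∧ deg β = n := by
  obtain ⟨i, hi⟩ : ∃ i, α i ≠ 0 := by
    by_contra! h0
    simp [deg, h0] at h
  have hα : α = (α - Pi.single i 1) + Pi.single i 1 := by
    ext j
    rcases eq_or_ne j i with rfl | hj
    · simp; omega
    · simp [hj]
  refine ⟨i, α - Pi.single i 1, hα, ?_⟩
  rw [hα, deg_add, deg_single] at h
  omega

theorem mono_add (α β : Fin 4 → ℕ) : F.mono α * F.mono β = F.mono (α + β) := by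
  induction h : deg α generalizing α with
  | zero =>
    obtain rfl : α = 0 := by
      ext i
      simpa [deg] using (Finset.sum_eq_zero_iff.mp h) i (Finset.mem_univ i)
    simp [mono_zero]
  | succ n ih =>
    obtain ⟨i, γ, rfl, hγ⟩ := exists_eq_add_single h
    rw [← op_mul_mono, mul_assoc, ih γ hγ, op_mul_mono]
    congr 1
    abel

theorem complex_smul (c : ℂ) (P : Module.End ℂ R) : c • P = algebraMap ℂ R c • P := by
  ext f
  simp [Algebra.smul_def]

theorem smul_mul (a : R) (P Q : Module.End ℂ R) : a • P * Q = a • (P * Q) := rfl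

theorem op_mul_smul (i : Fin 4) (a : R) (P : Module.End ℂ R) :
    F.op i * a • P = a • (F.op i * P) + F.op i a • P := by
  ext f
  simp [F.leibniz, mul_comm]

/-- The operators of order `< n`: the left `R`-span of the monomials of order `< n`. The strict
inequality makes `ops 0` the zero module, where the descent on the order ends. -/
noncomputable def ops (n : ℕ) : Submodule R (Module.End ℂ R) :=
  Submodule.span R {P | ∃ α, deg α < n ∧ P = F.mono α}

theorem mono_mem_ops {α : Fin 4 → ℕ} {n : ℕ} (h : deg α < n) : F.mono α ∈ F.ops n :=
  Submodule.subset_span ⟨α, h, rfl⟩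

theorem ops_mono {m n : ℕ} (h : m ≤ n) : F.ops m ≤ F.ops n :=
  Submodule.span_mono fun _ ⟨α, hα, hP⟩ => ⟨α, hα.trans_le h, hP⟩

theorem ops_zero : F.ops 0 = ⊥ := by
  simp [ops]

theorem one_mem_ops (n : ℕ) : (1 : Module.End ℂ R) ∈ F.ops (n + 1) := by
  simpa [mono_zero] using F.mono_mem_ops (α := 0) (n := n + 1) (by simp [deg_zero])

theorem op_mem_ops (i : Fin 4) : F.op i ∈ F.ops 2 := by
  simpa [mono_single] using F.mono_mem_ops (α := Pi.single i 1) (n := 2) (by simp [deg_single])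

theorem op_mul_mem_ops (i : Fin 4) {n : ℕ} {P : Module.End ℂ R} (hP : P ∈ F.ops n) :
    F.op i * P ∈ F.ops (n + 1) := by
  induction hP using Submodule.span_induction with
  | mem P h =>
    obtain ⟨α, hα, rfl⟩ := h
    rw [op_mul_mono]
    exact F.mono_mem_ops (by rw [deg_add, deg_single]; omega)
  | zero => simp
  | add P Q _ _ hP hQ => rw [mul_add]; exact add_mem hP hQ
  | smul a P hP h =>
    rw [op_mul_smul]
    exact add_mem (Submodule.smul_mem _ _ h)
      (Submodule.smul_mem _ _ (F.ops_mono n.le_succ hP))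

/-- If a family `S` of left submodules is stable under the derivations, with a shift by one, then
a monomial of order `m` maps `S n` to `S (m + n)`. -/
theorem mono_mul_mem_of_stable (S : ℕ → Submodule R (Module.End ℂ R))
    (hS : ∀ i n, ∀ P ∈ S n, F.op i * P ∈ S (n + 1)) (α : Fin 4 → ℕ) {n : ℕ}
    {P : Module.End ℂ R} (hP : P ∈ S n) : F.mono α * P ∈ S (deg α + n) := by
  induction h : deg α generalizing α with
  | zero =>
    obtain rfl : α = 0 := by
      ext i
      simpa [deg] using (Finset.sum_eq_zero_iff.mp h) i (Finset.mem_univ i)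
    simpa [mono_zero] using hP
  | succ k ih =>
    obtain ⟨i, γ, rfl, hγ⟩ := exists_eq_add_single h
    rw [← op_mul_mono, mul_assoc, add_right_comm]
    exact hS _ _ _ (ih γ hγ)

theorem mul_mem_of_stable (S : ℕ → Submodule R (Module.End ℂ R)) (hmono : Monotone S)
    (hS : ∀ i n, ∀ P ∈ S n, F.op i * P ∈ S (n + 1)) {m n : ℕ}
    {P Q : Module.End ℂ R} (hP : P ∈ F.ops (m + 1)) (hQ : Q ∈ S n) : P * Q ∈ S (m + n) := by
  induction hP using Submodule.span_induction with
  | mem P h =>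
    obtain ⟨α, hα, rfl⟩ := h
    exact hmono (by omega) (F.mono_mul_mem_of_stable S hS α hQ)
  | zero => simp
  | add P P' _ _ hP hP' => rw [add_mul]; exact add_mem hP hP'
  | smul a P _ h => rw [smul_mul]; exact Submodule.smul_mem _ _ h

theorem mul_mem_ops {m n : ℕ} {P Q : Module.End ℂ R} (hP : P ∈ F.ops (m + 1))
    (hQ : Q ∈ F.ops n) : P * Q ∈ F.ops (m + n) :=
  F.mul_mem_of_stable F.ops (fun _ _ h => F.ops_mono h) (fun i _ _ h => F.op_mul_mem_ops i h) hP hQ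

theorem pow_mem_ops {m : ℕ} {P : Module.End ℂ R} (hP : P ∈ F.ops (m + 1)) (k : ℕ) :
    P ^ k ∈ F.ops (m * k + 1) := by
  induction k with
  | zero => simpa using F.one_mem_ops 0
  | succ k ih =>
    rw [pow_succ', mul_add_one, add_comm (m * k), add_assoc]
    exact F.mul_mem_ops hP ih

theorem mem_ops_of_mem_span {P : Module.End ℂ R} (hP : P ∈ Submodule.span R (Set.range F.mono)) :
    ∃ n, P ∈ F.ops n := by
  induction hP using Submodule.span_induction with
  | mem P h => obtain ⟨α, rfl⟩ := h; exact ⟨_, F.mono_mem_ops (Nat.lt_succ_self _)⟩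
  | zero => exact ⟨0, zero_mem _⟩
  | add P Q _ _ hP hQ =>
    obtain ⟨m, hm⟩ := hP
    obtain ⟨n, hn⟩ := hQ
    exact ⟨max m n, add_mem (F.ops_mono (le_max_left _ _) hm) (F.ops_mono (le_max_right _ _) hn)⟩
  | smul a P _ h => obtain ⟨n, hn⟩ := h; exact ⟨n, Submodule.smul_mem _ _ hn⟩

theorem ops_le_span (n : ℕ) : F.ops n ≤ Submodule.span R (Set.range F.mono) :=
  Submodule.span_mono fun _ ⟨α, _, hP⟩ => ⟨α, hP.symm⟩

theorem op_one (i : Fin 4) : F.op i 1 = 0 := by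
  simpa using F.leibniz i 1 1

theorem op_algebraMap (i : Fin 4) (c : ℂ) : F.op i (algebraMap ℂ R c) = 0 := by
  rw [Algebra.algebraMap_eq_smul_one, map_smul, op_one, smul_zero]

theorem op_inverse (i : Fin 4) {a b : R} (h : a * b = 1) : F.op i b = -b ^ 2 * F.op i a := by
  have h1 := F.leibniz i a b
  rw [h, op_one] at h1
  linear_combination (-b) * h1 - F.op i b * h

/-- Monomials in one frame are differential operators with respect to another one whose span
contains the derivations of the first. -/
theorem mono_mem_ops_of_op_mem {F G : Frame R}
    (h : ∀ i, G.op i ∈ F.ops 2) (α : Fin 4 → ℕ) : ∃ n, G.mono α ∈ F.ops n := by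
  have hp (i : Fin 4) : G.op i ^ α i ∈ F.ops (1 * α i + 1) := F.pow_mem_ops (h i) (α i)
  have h1 := F.mul_mem_ops (hp 0) (hp 1)
  have h2 := F.mul_mem_ops (F.ops_mono (Nat.le_succ _) h1) (hp 2)
  have h3 := F.mul_mem_ops (F.ops_mono (Nat.le_succ _) h2) (hp 3)
  exact ⟨_, h3⟩

theorem sub_mem_ops {F : Frame R} {n : ℕ}
    {P Q : Module.End ℂ R} (hP : P ∈ F.ops n) (hQ : Q ∈ F.ops n) : P - Q ∈ F.ops n :=
  sub_mem hP hQ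

theorem ops_le_span_of_op_mem {F G : Frame R}
    (h : ∀ i, G.op i ∈ F.ops 2) (n : ℕ) :
    G.ops n ≤ Submodule.span R (Set.range F.mono) := by
  refine (G.ops_le_span n).trans (Submodule.span_le.mpr ?_)
  rintro _ ⟨α, rfl⟩
  obtain ⟨n, hn⟩ := mono_mem_ops_of_op_mem h α
  exact F.ops_le_span n hn

theorem complex_smul_mem_ops {F : Frame R} {n : ℕ}
    {P : Module.End ℂ R} (hP : P ∈ F.ops n) (c : ℂ) : c • P ∈ F.ops n := by
  rw [complex_smul]
  exact Submodule.smul_mem _ _ hP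

/-! ### Leading terms at a point -/

variable (ε : R →ₐ[ℂ] ℂ)

/-- The operators of order `≤ n` whose principal symbol of order `n` vanishes at the point `ε`:
they are spanned by the operators of order `< n` and by the multiples `a ∂^α` with `|α| = n`
and `ε a = 0`. -/
noncomputable def negligible (n : ℕ) : Submodule R (Module.End ℂ R) :=
  F.ops n ⊔ RingHom.ker ε • F.ops (n + 1)

theorem negligible_le_ops (n : ℕ) : F.negligible ε n ≤ F.ops (n + 1) :=
  sup_le (F.ops_mono n.le_succ) Submodule.smul_le_right

theorem ops_le_negligible (n : ℕ) : F.ops n ≤ F.negligible ε n := le_sup_left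

theorem smul_mem_negligible {a : R} (ha : ε a = 0) {n : ℕ} {P : Module.End ℂ R}
    (hP : P ∈ F.ops (n + 1)) : a • P ∈ F.negligible ε n :=
  (le_sup_right : _ ≤ F.negligible ε n) (Submodule.smul_mem_smul ((RingHom.mem_ker).mpr ha) hP)

theorem negligible_mono : Monotone (F.negligible ε) := fun _ _ h =>
  sup_le_sup (F.ops_mono h) (smul_mono_right _ (F.ops_mono (Nat.succ_le_succ h)))

theorem negligible_induction {n : ℕ} {p : Module.End ℂ R → Prop}
    (hops : ∀ P ∈ F.ops n, p P) (hker : ∀ a, ε a = 0 → ∀ P ∈ F.ops (n + 1), p (a • P))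
    (hadd : ∀ P Q, p P → p Q → p (P + Q)) {P : Module.End ℂ R} (hP : P ∈ F.negligible ε n) : p P := by
  obtain ⟨Q, hQ, Q', hQ', rfl⟩ := Submodule.mem_sup.mp hP
  refine hadd _ _ (hops _ hQ) ?_
  exact Submodule.smul_induction_on hQ' (fun a ha P hP => hker a (RingHom.mem_ker.mp ha) P hP) hadd

theorem op_mul_mem_negligible (i : Fin 4) (n : ℕ) (P : Module.End ℂ R) (hP : P ∈ F.negligible ε n) :
    F.op i * P ∈ F.negligible ε (n + 1) := by
  refine F.negligible_induction ε (p := fun P => F.op i * P ∈ F.negligible ε (n + 1)) (fun P hP => ?_) (fun a ha P hP => ?_) (fun P Q hP hQ => ?_) hP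
  · exact F.ops_le_negligible ε _ (F.op_mul_mem_ops i hP)
  · rw [op_mul_smul]
    exact add_mem (F.smul_mem_negligible ε ha (F.op_mul_mem_ops i hP))
      (F.ops_le_negligible ε _ (Submodule.smul_mem _ _ hP))
  · rw [mul_add]; exact add_mem hP hQ

theorem mul_mem_negligible {m n : ℕ} {P Q : Module.End ℂ R} (hP : P ∈ F.ops (m + 1))
    (hQ : Q ∈ F.negligible ε n) : P * Q ∈ F.negligible ε (m + n) :=
  F.mul_mem_of_stable (F.negligible ε) (F.negligible_mono ε) (F.op_mul_mem_negligible ε) hP hQ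

theorem mul_mem_negligible_of_left {m n : ℕ} {P Q : Module.End ℂ R} (hP : P ∈ F.negligible ε m)
    (hQ : Q ∈ F.ops (n + 1)) : P * Q ∈ F.negligible ε (m + n) := by
  refine F.negligible_induction ε (p := fun P => P * Q ∈ F.negligible ε (m + n)) (fun P hP => ?_) (fun a ha P hP => ?_) (fun P Q hP hQ => ?_) hP
  · rcases m with - | m
    · rw [ops_zero] at hP
      simp [(Submodule.mem_bot R).mp hP]
    · refine F.ops_le_negligible ε _ ?_
      rw [Nat.add_right_comm, add_assoc]
      exact F.mul_mem_ops hP hQ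
  · rw [smul_mul]
    have h := F.mul_mem_ops hP hQ
    exact F.smul_mem_negligible ε ha h
  · rw [add_mul]; exact add_mem hP hQ

/-- `P` has order `|α|` and its principal symbol at the point `ε` is that of `∂^α`. -/
def HasLeading (P : Module.End ℂ R) (α : Fin 4 → ℕ) : Prop := P - F.mono α ∈ F.negligible ε (deg α)

variable {F ε}

theorem HasLeading.mem_ops {P : Module.End ℂ R} {α : Fin 4 → ℕ} (h : F.HasLeading ε P α) :
    P ∈ F.ops (deg α + 1) := by
  simpa using add_mem (F.negligible_le_ops ε _ h) (F.mono_mem_ops (Nat.lt_succ_self (deg α)))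

/-- Leading terms are multiplicative: a derivation commutes with a coefficient up to an operator of
lower order, and negligible operators form a two-sided ideal for the filtration. -/
theorem HasLeading.mul {P Q : Module.End ℂ R} {α β : Fin 4 → ℕ} (hP : F.HasLeading ε P α)
    (hQ : F.HasLeading ε Q β) : F.HasLeading ε (P * Q) (α + β) := by
  have h1 := F.mul_mem_negligible ε hP.mem_ops hQ
  have h2 := F.mul_mem_negligible_of_left ε hP (F.mono_mem_ops (Nat.lt_succ_self (deg β)))
  have h3 := add_mem h1 h2
  rw [← deg_add] at h3
  rw [HasLeading, ← F.mono_add]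
  convert h3 using 1
  rw [mul_sub, sub_mul, sub_add_sub_cancel]

theorem hasLeading_one : F.HasLeading ε 1 0 := by
  simp [HasLeading, mono_zero]

theorem HasLeading.pow {P : Module.End ℂ R} {α : Fin 4 → ℕ} (hP : F.HasLeading ε P α) (k : ℕ) :
    F.HasLeading ε (P ^ k) (k • α) := by
  induction k with
  | zero => simpa using hasLeading_one
  | succ k ih => rw [pow_succ, succ_nsmul]; exact ih.mul hP

theorem hasLeading_op (i : Fin 4) : F.HasLeading ε (F.op i) (Pi.single i 1) := by
  simp [HasLeading, mono_single]

/-- Only the value at `ε` of a coefficient matters for the leading term. -/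
theorem HasLeading.smul {P : Module.End ℂ R} {α : Fin 4 → ℕ} (hP : F.HasLeading ε P α) {a : R}
    (ha : ε a = 1) : F.HasLeading ε (a • P) α := by
  have h := F.smul_mem_negligible ε (a := a - 1) (by simp [ha]) hP.mem_ops
  have h2 := add_mem h hP
  rw [HasLeading]
  convert h2 using 1
  ext f
  simp only [LinearMap.sub_apply, LinearMap.add_apply, LinearMap.smul_apply, smul_eq_mul]
  ring

theorem HasLeading.add_smul {P Q : Module.End ℂ R} {α : Fin 4 → ℕ} (hP : F.HasLeading ε P α)
    {a : R} (ha : ε a = 0) (hQ : Q ∈ F.ops (deg α + 1)) : F.HasLeading ε (P + a • Q) α := by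
  rw [HasLeading, add_sub_right_comm]
  exact add_mem hP (F.smul_mem_negligible ε ha hQ)

variable (F ε)

/-- Modulo negligible operators, coefficients can be replaced by their values at `ε`: an operator
of order `≤ n` is a combination of monomials of order `n` with constant coefficients. -/
theorem exists_sub_mem_negligible {n : ℕ} {P : Module.End ℂ R} (hP : P ∈ F.ops (n + 1)) :
    ∃ c : (Fin 4 → ℕ) →₀ ℂ, (∀ α ∈ c.support, deg α = n) ∧
      P - c.sum (fun α z => z • F.mono α) ∈ F.negligible ε n := by
  induction hP using Submodule.span_induction with
  | mem P h =>
    obtain ⟨α, hα, rfl⟩ := h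
    rcases Nat.lt_succ_iff_lt_or_eq.mp hα with hlt | heq
    · exact ⟨0, by simp, by simpa using F.ops_le_negligible ε _ (F.mono_mem_ops hlt)⟩
    · classical
      refine ⟨Finsupp.single α 1, fun β hβ => ?_, by simp⟩
      rw [Finset.mem_singleton.mp (Finsupp.support_single_subset hβ), heq]
  | zero => exact ⟨0, by simp, by simp⟩
  | add P Q _ _ hP hQ =>
    classical
    obtain ⟨c, hc, hcP⟩ := hP
    obtain ⟨c', hc', hcQ⟩ := hQ
    refine ⟨c + c', fun α hα => ?_, ?_⟩
    · rcases Finset.mem_union.mp (Finsupp.support_add hα) with h | h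
      exacts [hc α h, hc' α h]
    · rw [Finsupp.sum_add_index' (by simp) (by intros; rw [_root_.add_smul])]
      convert add_mem hcP hcQ using 1
      abel
  | smul a P hP h =>
    obtain ⟨c, hc, hcP⟩ := h
    refine ⟨ε a • c, fun α hα => hc α (Finsupp.support_smul hα), ?_⟩
    have hs : c.sum (fun α z => z • F.mono α) ∈ F.ops (n + 1) :=
      Submodule.sum_mem _ fun α hα => by
        change c α • F.mono α ∈ _
        rw [complex_smul]
        exact Submodule.smul_mem _ _ (F.mono_mem_ops (by rw [hc α hα]; exact n.lt_succ_self))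
    have h1 := F.smul_mem_negligible ε (a := a - algebraMap ℂ R (ε a)) (by simp) hs
    convert add_mem h1 (Submodule.smul_mem _ a hcP) using 1
    have h2 : (ε a • c).sum (fun α z => z • F.mono α) = ε a • c.sum (fun α z => z • F.mono α) := by
      rw [Finsupp.sum_smul_index' (by simp), Finsupp.smul_sum]
      simp only [smul_assoc]
    rw [h2, complex_smul]
    ext f
    simp only [LinearMap.sub_apply, LinearMap.add_apply, LinearMap.smul_apply, smul_eq_mul]
    ring

/-! ### Detecting leading terms with test functions -/

theorem op_mem_ker_pow (i : Fin 4) {k : ℕ} {f : R} (hf : f ∈ RingHom.ker ε ^ (k + 1)) :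
    F.op i f ∈ RingHom.ker ε ^ k := by
  induction k generalizing f with
  | zero => simp
  | succ k ih =>
    rw [pow_succ] at hf
    refine Submodule.mul_induction_on hf (fun a ha b hb => ?_) (fun a b ha hb => ?_)
    · rw [F.leibniz]
      refine add_mem (Ideal.mul_mem_right _ _ ha) ?_
      rw [pow_succ']
      exact Ideal.mul_mem_mul hb (ih ha)
    · rw [map_add]; exact add_mem ha hb

theorem mono_mem_ker_pow (α : Fin 4 → ℕ) {k : ℕ} {f : R}
    (hf : f ∈ RingHom.ker ε ^ (deg α + k)) : F.mono α f ∈ RingHom.ker ε ^ k := by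
  induction h : deg α generalizing α k with
  | zero =>
    obtain rfl : α = 0 := by
      ext i
      simpa [deg] using (Finset.sum_eq_zero_iff.mp h) i (Finset.mem_univ i)
    simpa [mono_zero, h] using hf
  | succ n ih =>
    obtain ⟨i, γ, rfl, hγ⟩ := exists_eq_add_single h
    rw [← op_mul_mono, Module.End.mul_apply]
    refine F.op_mem_ker_pow ε i (ih γ ?_ hγ)
    rw [h] at hf
    rwa [hγ, add_comm k, ← add_assoc]

/-- An operator of order `< n` does not see functions vanishing to order `n` at `ε`. -/
theorem eval_ops_eq_zero {n : ℕ} {P : Module.End ℂ R} (hP : P ∈ F.ops n) {f : R}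
    (hf : f ∈ RingHom.ker ε ^ n) : ε (P f) = 0 := by
  induction hP using Submodule.span_induction with
  | mem P h =>
    obtain ⟨α, hα, rfl⟩ := h
    have : f ∈ RingHom.ker ε ^ (deg α + 1) := Ideal.pow_le_pow_right hα hf
    simpa using F.mono_mem_ker_pow ε α this
  | zero => simp
  | add P Q _ _ hP hQ => simp [hP, hQ]
  | smul a P _ h => simp [h]

theorem eval_negligible_eq_zero {n : ℕ} {P : Module.End ℂ R} (hP : P ∈ F.negligible ε n) {f : R}
    (hf : f ∈ RingHom.ker ε ^ n) : ε (P f) = 0 := by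
  refine F.negligible_induction ε (p := fun P => ε (P f) = 0) (fun P hP => ?_) (fun a ha P hP => ?_) (fun P Q hP hQ => ?_) hP
  · exact F.eval_ops_eq_zero ε hP hf
  · simp [ha]
  · simp [hP, hQ]

/-- Near the point `ε` an operator with negligible leading part acts like one of lower order. -/
theorem exists_ops_eval_eq {n : ℕ} {P : Module.End ℂ R} (hP : P ∈ F.negligible ε n) :
    ∃ Q ∈ F.ops n, ∀ f, ε (P f) = ε (Q f) := by
  refine F.negligible_induction ε (p := fun P => ∃ Q ∈ F.ops n, ∀ f, ε (P f) = ε (Q f))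
    (fun P hP => ⟨P, hP, fun _ => rfl⟩)
    (fun a ha P hP => ⟨0, zero_mem _, by simp [ha]⟩) (fun P Q hP hQ => ?_) hP
  obtain ⟨P', hP', h⟩ := hP
  obtain ⟨Q', hQ', h'⟩ := hQ
  exact ⟨P' + Q', add_mem hP' hQ', by simp [h, h']⟩

theorem testFun_mem_ker_pow {t : Fin 4 → R} (ht : ∀ i, ε (t i) = 0) (β : Fin 4 → ℕ) :
    testFun t β ∈ RingHom.ker ε ^ deg β := by
  rw [deg, ← Finset.prod_pow_eq_pow_sum]
  exact Ideal.prod_mem_prod fun i _ => Ideal.pow_mem_pow (RingHom.mem_ker.mpr (ht i)) _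

/-- Up to higher order at `ε`, the derivations differentiate the test functions like the partial
derivatives differentiate monomials, if the `t i` are dual to the frame at `ε`. -/
theorem op_testFun {t : Fin 4 → R} (ht : ∀ i, ε (t i) = 0)
    (hd : ∀ i j, ε (F.op i (t j)) = if i = j then 1 else 0) (i : Fin 4) (β : Fin 4 → ℕ) :
    F.op i (testFun t β) - (β i : ℂ) • testFun t (β - Pi.single i 1) ∈ RingHom.ker ε ^ deg β := by
  induction h : deg β generalizing β with
  | zero => simp
  | succ n ih =>
    obtain ⟨j, γ, rfl, hγ⟩ := exists_eq_add_single h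
    have h1 : F.op i (t j) - (if i = j then 1 else 0) ∈ RingHom.ker ε := by
      rw [RingHom.mem_ker, map_sub, hd]; split_ifs <;> simp
    have h2 := Ideal.mul_mem_mul h1 (testFun_mem_ker_pow ε ht γ)
    have h3 := Ideal.mul_mem_mul (RingHom.mem_ker.mpr (ht j)) (ih γ hγ)
    rw [hγ, ← pow_succ'] at h2
    rw [← pow_succ'] at h3
    convert add_mem h2 h3 using 1
    rw [testFun_add_single, F.leibniz]
    -- `t j * (γ i • t^(γ - e_i))` is `γ i • t^(γ + e_j - e_i)`, also when `γ i = 0`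
    have key : t j * ((γ i : ℂ) • testFun t (γ - Pi.single i 1)) =
        (γ i : ℂ) • testFun t (γ + Pi.single j 1 - Pi.single i 1) := by
      rcases Nat.eq_zero_or_pos (γ i) with h0 | h0
      · simp [h0]
      · rw [mul_smul_comm, ← testFun_add_single]
        congr 2
        ext k
        rcases eq_or_ne k i with rfl | hk
        · simp only [Pi.add_apply, Pi.sub_apply, Pi.single_eq_same]; omega
        · simp [hk]
    rw [mul_sub, key]
    rcases eq_or_ne i j with rfl | hij
    · simp only [add_tsub_cancel_right, if_true, Pi.add_apply, Pi.single_eq_same, Nat.cast_add,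
        Nat.cast_one, _root_.add_smul, one_smul]
      ring
    · simp only [if_neg hij, Pi.add_apply, Pi.single_eq_of_ne hij, add_zero]
      ring

/-- Monomials and test functions of the same order are dual to each other, up to factorials. -/
theorem eval_mono_testFun {t : Fin 4 → R} (ht : ∀ i, ε (t i) = 0)
    (hd : ∀ i j, ε (F.op i (t j)) = if i = j then 1 else 0) {α β : Fin 4 → ℕ}
    (h : deg α = deg β) :
    (α ≠ β → ε (F.mono α (testFun t β)) = 0) ∧ (α = β → ε (F.mono α (testFun t β)) ≠ 0) := by
  induction hn : deg α generalizing α β with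
  | zero =>
    have hz {γ : Fin 4 → ℕ} (hγ : deg γ = 0) : γ = 0 := by
      ext i
      simpa [deg] using (Finset.sum_eq_zero_iff.mp hγ) i (Finset.mem_univ i)
    obtain rfl := hz hn
    obtain rfl := hz (h.symm.trans hn)
    simp [mono_zero, testFun]
  | succ n ih =>
    obtain ⟨i, γ, rfl, hγ⟩ := exists_eq_add_single hn
    have hβ : deg β = n + 1 := h.symm.trans hn
    have e1 : ε (F.mono (γ + Pi.single i 1) (testFun t β)) =
        β i * ε (F.mono γ (testFun t (β - Pi.single i 1))) := by
      have h1 := F.op_testFun ε ht hd i β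
      rw [hβ, ← hγ] at h1
      have h2 := F.mono_mem_ker_pow ε γ h1
      rw [pow_one, RingHom.mem_ker, map_sub, map_sub, map_smul, map_smul, smul_eq_mul,
        sub_eq_zero] at h2
      rw [← mono_add, mono_single, Module.End.mul_apply, h2]
    rcases Nat.eq_zero_or_pos (β i) with h0 | h0
    · refine ⟨fun _ => by rw [e1, h0]; simp, fun heq => ?_⟩
      rw [← heq] at h0
      simp at h0
    · have hb : β = (β - Pi.single i 1) + Pi.single i 1 := by
        ext j
        rcases eq_or_ne j i with rfl | hj
        · simp; omega
        · simp [hj]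
      have hbd : deg (β - Pi.single i 1) = n := by
        rw [hb, deg_add, deg_single] at hβ
        omega
      have := ih (hγ.trans hbd.symm) hγ
      rw [e1]
      refine ⟨fun hne => ?_, fun heq => ?_⟩
      · rw [this.1 (fun hh => hne (by rw [hh, ← hb])), mul_zero]
      · have hi : (β i : ℂ) ≠ 0 := by exact_mod_cast h0.ne'
        refine mul_ne_zero hi (this.2 ?_)
        rw [← heq, add_tsub_cancel_right]

/-- The descent on the order. Let `A` be a subalgebra of operators satisfying `inv`, a condition
which makes an operator vanish when its value at the point `ε` does, and annihilates the test
functions outside the set of multi-indices `W` at `ε`. If `A` contains operators with leading term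
`∂^α` for all `α ∈ W`, then `A` contains all operators satisfying `inv`. -/
theorem mem_of_leading (A : Subalgebra ℂ (Module.End ℂ R)) (inv : Submodule ℂ (Module.End ℂ R))
    (hA : ∀ P ∈ A, P ∈ inv) (hzero : ∀ P ∈ inv, (∀ f, ε (P f) = 0) → P = 0)
    {t : Fin 4 → R} (ht : ∀ i, ε (t i) = 0)
    (hd : ∀ i j, ε (F.op i (t j)) = if i = j then 1 else 0) (W : Set (Fin 4 → ℕ))
    (hW : ∀ P ∈ inv, ∀ β ∉ W, ε (P (testFun t β)) = 0)
    (hlead : ∀ α ∈ W, ∃ P ∈ A, F.HasLeading ε P α) {n : ℕ} {P Q : Module.End ℂ R}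
    (hP : P ∈ inv) (hQ : Q ∈ F.ops n) (hPQ : ∀ f, ε (P f) = ε (Q f)) : P ∈ A := by
  induction n generalizing P Q with
  | zero =>
    rw [ops_zero] at hQ
    obtain rfl := (Submodule.mem_bot R).mp hQ
    rw [hzero P hP (by simpa using hPQ)]
    exact zero_mem A
  | succ n ih =>
    obtain ⟨c, hc, hcQ⟩ := F.exists_sub_mem_negligible ε hQ
    have hcW : ∀ β ∈ c.support, β ∈ W := by
      intro β hβ
      by_contra hβW
      have h1 := F.eval_negligible_eq_zero ε hcQ (hc β hβ ▸ testFun_mem_ker_pow ε ht β)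
      have h2 : ε (c.sum (fun α z => z • F.mono α) (testFun t β)) =
          c β * ε (F.mono β (testFun t β)) := by
        rw [Finsupp.sum, LinearMap.sum_apply, map_sum, Finset.sum_eq_single β]
        · simp
        · intro α hα hne
          simp [(F.eval_mono_testFun ε ht hd ((hc α hα).trans (hc β hβ).symm)).1 hne]
        · exact fun h => absurd hβ h
      rw [LinearMap.sub_apply, map_sub, h2, ← hPQ, hW P hP β hβW, zero_sub, neg_eq_zero] at h1
      exact mul_ne_zero (Finsupp.mem_support_iff.mp hβ)
        ((F.eval_mono_testFun ε ht hd rfl).2 rfl) h1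
    choose! L hLA hL using hlead
    set S : Module.End ℂ R := c.sum (fun α z => z • L α) with hS
    have hSA : S ∈ A := sum_mem fun α hα => A.smul_mem (hLA α (hcW α hα)) _
    have hQS : Q - S ∈ F.negligible ε n := by
      have h : c.sum (fun α z => z • F.mono α) - S ∈ F.negligible ε n := by
        rw [hS, Finsupp.sum, Finsupp.sum, ← Finset.sum_sub_distrib]
        refine sum_mem fun α hα => ?_
        rw [show c α • F.mono α - c α • L α = c α • (F.mono α - L α) from
          (smul_sub (c α) (F.mono α) (L α)).symm, complex_smul]
        refine Submodule.smul_mem _ _ ?_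
        have := hL α (hcW α hα)
        rw [HasLeading, hc α hα] at this
        rw [← neg_sub]
        exact neg_mem this
      simpa using add_mem hcQ h
    obtain ⟨Q', hQ', h⟩ := F.exists_ops_eval_eq ε hQS
    have := ih (P := P - S) (sub_mem hP (hA S hSA)) hQ' (fun f => by
      rw [← h, LinearMap.sub_apply, LinearMap.sub_apply, map_sub, map_sub, hPQ])
    simpa using add_mem this hSA

end Frame

/-! ### Smooth functions and their directional derivatives -/

theorem smoothFunctions_ext {f g : smoothFunctions}
    (h : ∀ p, (f : ℍ × ℂ → ℂ) p = (g : ℍ × ℂ → ℂ) p) : f = g :=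
  Subtype.ext (funext h)

/-- Stated for general `R`: on `Module.End ℂ smoothFunctions` the subtraction found by unification
is not the one of a ring structure, so that `sub_mem` does not apply directly. -/
theorem sub_mem_subalgebra {R : Type*} [CommRing R] [Algebra ℂ R]
    {A : Subalgebra ℂ (Module.End ℂ R)} {P Q : Module.End ℂ R} (hP : P ∈ A) (hQ : Q ∈ A) :
    P - Q ∈ A :=
  sub_mem hP hQ

theorem commute_add_sub {R : Type*} [CommRing R] [Algebra ℂ R] {T a b : Module.End ℂ R}
    (ha : Commute T a) (hb : Commute T b) (c d : ℂ) :
    Commute T (d • (a + c • b)) ∧ Commute T (d • (a - c • b)) :=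
  ⟨(ha.add_right (hb.smul_right c)).smul_right _, (ha.sub_right (hb.smul_right c)).smul_right _⟩

theorem mem_domain (p : ℍ × ℂ) : ((p.1 : ℂ), p.2) ∈ domain := p.1.im_pos

theorem extend_of_mem (f : ℍ × ℂ → ℂ) {q : ℂ × ℂ} (hq : q ∈ domain) :
    extend f q = f (⟨q.1, hq⟩, q.2) :=
  extend_coe f (⟨q.1, hq⟩, q.2)

theorem contDiffAt_extend (f : smoothFunctions) (p : ℍ × ℂ) :
    ContDiffAt ℝ ∞ (extend f) ((p.1 : ℂ), p.2) :=
  (mem_smoothFunctions.mp f.2).contDiffAt (isOpen_domain.mem_nhds (mem_domain p))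

theorem differentiableAt_extend (f : smoothFunctions) (p : ℍ × ℂ) :
    DifferentiableAt ℝ (extend f) ((p.1 : ℂ), p.2) :=
  (contDiffAt_extend f p).differentiableAt (by simp)

theorem extend_eventuallyEq {f : ℍ × ℂ → ℂ} {F : ℂ × ℂ → ℂ}
    (h : ∀ q : ℍ × ℂ, f q = F ((q.1 : ℂ), q.2)) (p : ℍ × ℂ) :
    extend f =ᶠ[nhds ((p.1 : ℂ), p.2)] F := by
  filter_upwards [isOpen_domain.mem_nhds (mem_domain p)] with q hq
  rw [extend_of_mem f hq, h]

theorem dirDeriv_apply (w : ℂ × ℂ) (f : smoothFunctions) (p : ℍ × ℂ) :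
    (dirDeriv w f : ℍ × ℂ → ℂ) p = fderiv ℝ (extend f) ((p.1 : ℂ), p.2) w := rfl

theorem dirDeriv_apply_of_hasFDerivAt {f : smoothFunctions} {F : ℂ × ℂ → ℂ} {p : ℍ × ℂ}
    {L : ℂ × ℂ →L[ℝ] ℂ} (h : ∀ q : ℍ × ℂ, (f : ℍ × ℂ → ℂ) q = F ((q.1 : ℂ), q.2))
    (hF : HasFDerivAt F L ((p.1 : ℂ), p.2)) (w : ℂ × ℂ) :
    (dirDeriv w f : ℍ × ℂ → ℂ) p = L w := by
  rw [dirDeriv_apply, ((hF.congr_of_eventuallyEq (extend_eventuallyEq h p))).fderiv]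

theorem dirDeriv_mul (w : ℂ × ℂ) (f g : smoothFunctions) :
    dirDeriv w (f * g) = f * dirDeriv w g + g * dirDeriv w f := by
  refine smoothFunctions_ext fun p => ?_
  have h := (differentiableAt_extend f p).hasFDerivAt.mul (differentiableAt_extend g p).hasFDerivAt
  rw [dirDeriv_apply_of_hasFDerivAt (F := extend f * extend g) (fun q => ?_) h w]
  · simp [dirDeriv_apply, extend_coe]
  · simp [extend_coe]

theorem dirDeriv_commute (w w' : ℂ × ℂ) : Commute (dirDeriv w) (dirDeriv w') := by
  have key (w w' : ℂ × ℂ) (f : smoothFunctions) (p : ℍ × ℂ) :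
      (dirDeriv w (dirDeriv w' f) : ℍ × ℂ → ℂ) p =
        fderiv ℝ (fderiv ℝ (extend f)) ((p.1 : ℂ), p.2) w w' := by
    have hd : DifferentiableAt ℝ (fderiv ℝ (extend f)) ((p.1 : ℂ), p.2) :=
      ((contDiffAt_extend f p).fderiv_right (m := 1)
        (one_add_one_eq_two (R := WithTop ℕ∞) ▸ ENat.LEInfty.out)).differentiableAt
        (by simp)
    rw [dirDeriv_apply_of_hasFDerivAt (F := fun q => fderiv ℝ (extend f) q w') (fun q => rfl)
      (hd.hasFDerivAt.clm_apply (hasFDerivAt_const w' _)) w]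
    simp
  refine LinearMap.ext fun f => smoothFunctions_ext fun p => ?_
  rw [Module.End.mul_apply, Module.End.mul_apply, key, key]
  exact (contDiffAt_extend f p).isSymmSndFDerivAt
    (by simpa using (ENat.LEInfty.out : (2 : WithTop ℕ∞) ≤ ∞)) w w'

theorem dirDeriv_coord (α β : ℂ) (f : smoothFunctions) (p : ℍ × ℂ) :
    fderiv ℝ (extend f) ((p.1 : ℂ), p.2) (α, β) =
      α.re * (dx f : ℍ × ℂ → ℂ) p + α.im * (dy f : ℍ × ℂ → ℂ) p
        + β.re * (du f : ℍ × ℂ → ℂ) p + β.im * (dv f : ℍ × ℂ → ℂ) p := by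
  have h : ((α, β) : ℂ × ℂ) = α.re • (1, 0) + α.im • (Complex.I, 0) + β.re • (0, 1)
      + β.im • (0, Complex.I) := by
    ext <;> simp
  rw [h]
  simp only [map_add, map_smul, dx, dy, du, dv, dirDeriv_apply, Complex.real_smul]

/-! ### Wirtinger derivatives -/

/-- The Wirtinger derivative `∂/∂τ`. -/
noncomputable def dtau : Module.End ℂ smoothFunctions := (1 / 2 : ℂ) • (dx - Complex.I • dy)

/-- The Wirtinger derivative `∂/∂τ̄`. -/
noncomputable def dtauBar : Module.End ℂ smoothFunctions := (1 / 2 : ℂ) • (dx + Complex.I • dy)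

/-- The Wirtinger derivative `∂/∂z`. -/
noncomputable def dz : Module.End ℂ smoothFunctions := (1 / 2 : ℂ) • (du - Complex.I • dv)

/-- The Wirtinger derivative `∂/∂z̄`. -/
noncomputable def dzBar : Module.End ℂ smoothFunctions := (1 / 2 : ℂ) • (du + Complex.I • dv)

/-- The frame of the real partial derivatives. -/
noncomputable def realFrame : Frame smoothFunctions where
  op := ![dx, dy, du, dv]
  leibniz i a b := by fin_cases i <;> exact dirDeriv_mul _ a b
  commute i j := by fin_cases i <;> fin_cases j <;> exact dirDeriv_commute _ _

/-- The frame of the Wirtinger derivatives. -/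
noncomputable def wirtingerFrame : Frame smoothFunctions where
  op := ![dtau, dtauBar, dz, dzBar]
  leibniz i a b := by
    have h (c : ℂ) (w w' : ℂ × ℂ) : ((1 / 2 : ℂ) • (dirDeriv w + c • dirDeriv w')) (a * b) =
        a * ((1 / 2 : ℂ) • (dirDeriv w + c • dirDeriv w')) b
          + b * ((1 / 2 : ℂ) • (dirDeriv w + c • dirDeriv w')) a := by
      simp only [LinearMap.smul_apply, LinearMap.add_apply, dirDeriv_mul, smul_add, mul_add,
        mul_smul_comm]
      abel
    have h' (w w' : ℂ × ℂ) : (1 / 2 : ℂ) • (dirDeriv w - Complex.I • dirDeriv w') =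
        (1 / 2 : ℂ) • (dirDeriv w + (-Complex.I) • dirDeriv w') := by
      module
    fin_cases i
    · change dtau _ = _ * dtau _ + _ * dtau _
      rw [dtau, dx, dy, h']; exact h _ _ _
    · exact h _ _ _
    · change dz _ = _ * dz _ + _ * dz _
      rw [dz, du, dv, h']; exact h _ _ _
    · exact h _ _ _
  commute i j := by
    have hc (w w' : ℂ × ℂ) := dirDeriv_commute w w'
    have key (T : Module.End ℂ smoothFunctions) (h : ∀ w, Commute T (dirDeriv w)) :
        Commute T dtau ∧ Commute T dtauBar ∧ Commute T dz ∧ Commute T dzBar := by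
      have h' := @commute_add_sub _ _ _ T
      exact ⟨(h' (h _) (h _) _ _).2, (h' (h _) (h _) _ _).1, (h' (h _) (h _) _ _).2,
        (h' (h _) (h _) _ _).1⟩
    have key2 (w : ℂ × ℂ) := key (dirDeriv w) (fun w' => hc w w')
    have h1 := key dtau fun w => (key2 w).1.symm
    have h2 := key dtauBar fun w => (key2 w).2.1.symm
    have h3 := key dz fun w => (key2 w).2.2.1.symm
    have h4 := key dzBar fun w => (key2 w).2.2.2.symm
    fin_cases i <;> fin_cases j <;>
      first
      | exact h1.1 | exact h1.2.1 | exact h1.2.2.1 | exact h1.2.2.2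
      | exact h2.1 | exact h2.2.1 | exact h2.2.2.1 | exact h2.2.2.2
      | exact h3.1 | exact h3.2.1 | exact h3.2.2.1 | exact h3.2.2.2
      | exact h4.1 | exact h4.2.1 | exact h4.2.2.1 | exact h4.2.2.2

theorem dx_eq : dx = dtau + dtauBar := by
  rw [dtau, dtauBar]; module

theorem dy_eq : dy = Complex.I • (dtau - dtauBar) := by
  rw [dtau, dtauBar]
  have h : Complex.I * Complex.I = -1 := Complex.I_mul_I
  match_scalars
  · linear_combination h
  · ring

theorem du_eq : du = dz + dzBar := by
  rw [dz, dzBar]; module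

theorem dv_eq : dv = Complex.I • (dz - dzBar) := by
  rw [dz, dzBar]
  have h : Complex.I * Complex.I = -1 := Complex.I_mul_I
  match_scalars
  · linear_combination h
  · ring

theorem wirtinger_apply (f : smoothFunctions) (p : ℍ × ℂ) :
    (dtau f : ℍ × ℂ → ℂ) p
      = 1 / 2 * ((dx f : ℍ × ℂ → ℂ) p - Complex.I * (dy f : ℍ × ℂ → ℂ) p) ∧
    (dtauBar f : ℍ × ℂ → ℂ) p
      = 1 / 2 * ((dx f : ℍ × ℂ → ℂ) p + Complex.I * (dy f : ℍ × ℂ → ℂ) p) ∧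
    (dz f : ℍ × ℂ → ℂ) p
      = 1 / 2 * ((du f : ℍ × ℂ → ℂ) p - Complex.I * (dv f : ℍ × ℂ → ℂ) p) ∧
    (dzBar f : ℍ × ℂ → ℂ) p
      = 1 / 2 * ((du f : ℍ × ℂ → ℂ) p + Complex.I * (dv f : ℍ × ℂ → ℂ) p) :=
  ⟨rfl, rfl, rfl, rfl⟩

/-- The Wirtinger derivatives of a holomorphic function. -/
theorem wirtinger_of_holomorphic {f : smoothFunctions} {F : ℂ × ℂ → ℂ} {p : ℍ × ℂ} {A B : ℂ}
    (h : ∀ q : ℍ × ℂ, (f : ℍ × ℂ → ℂ) q = F ((q.1 : ℂ), q.2))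
    (hF : HasFDerivAt F (A • ContinuousLinearMap.fst ℂ ℂ ℂ + B • ContinuousLinearMap.snd ℂ ℂ ℂ)
      ((p.1 : ℂ), p.2)) :
    (dtau f : ℍ × ℂ → ℂ) p = A ∧ (dtauBar f : ℍ × ℂ → ℂ) p = 0 ∧
      (dz f : ℍ × ℂ → ℂ) p = B ∧ (dzBar f : ℍ × ℂ → ℂ) p = 0 := by
  have hd (w : ℂ × ℂ) := dirDeriv_apply_of_hasFDerivAt h (hF.restrictScalars ℝ) w
  have hI : Complex.I * Complex.I = -1 := Complex.I_mul_I
  obtain ⟨h1, h2, h3, h4⟩ := wirtinger_apply f p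
  rw [h1, h2, h3, h4]
  simp only [dx, dy, du, dv, hd]
  simp
  refine ⟨?_, ?_, ?_, ?_⟩
  · linear_combination (-A / 2) * hI
  · linear_combination A * hI
  · linear_combination (-B / 2) * hI
  · linear_combination B * hI

/-- The complex conjugate of a smooth function. -/
noncomputable def conjFun (f : smoothFunctions) : smoothFunctions :=
  ⟨fun p => starRingEnd ℂ ((f : ℍ × ℂ → ℂ) p),
    mem_smoothFunctions_of_eqOn (F := fun q => Complex.conjCLE (extend f q))
      (Complex.conjCLE.contDiff.comp_contDiffOn (mem_smoothFunctions.mp f.2))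
      fun p => by simp [extend_coe]⟩

theorem conjFun_apply (f : smoothFunctions) (p : ℍ × ℂ) :
    (conjFun f : ℍ × ℂ → ℂ) p = starRingEnd ℂ ((f : ℍ × ℂ → ℂ) p) := rfl

theorem conjFun_conjFun (f : smoothFunctions) : conjFun (conjFun f) = f :=
  smoothFunctions_ext fun p => by simp [conjFun_apply]

theorem conjFun_mul (f g : smoothFunctions) : conjFun (f * g) = conjFun f * conjFun g :=
  smoothFunctions_ext fun p => by simp [conjFun_apply]

theorem conjFun_add (f g : smoothFunctions) : conjFun (f + g) = conjFun f + conjFun g :=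
  smoothFunctions_ext fun p => by simp [conjFun_apply]

theorem dirDeriv_conjFun (w : ℂ × ℂ) (f : smoothFunctions) :
    dirDeriv w (conjFun f) = conjFun (dirDeriv w f) := by
  refine smoothFunctions_ext fun p => ?_
  rw [dirDeriv_apply_of_hasFDerivAt (F := fun q => Complex.conjCLE (extend f q))
    (fun q => by simp [extend_coe, conjFun_apply])
    (Complex.conjCLE.hasFDerivAt.comp _ (differentiableAt_extend f p).hasFDerivAt) w]
  simp [conjFun_apply, dirDeriv_apply]

theorem wirtinger_conjFun (f : smoothFunctions) :
    dtau (conjFun f) = conjFun (dtauBar f) ∧ dtauBar (conjFun f) = conjFun (dtau f) ∧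
      dz (conjFun f) = conjFun (dzBar f) ∧ dzBar (conjFun f) = conjFun (dz f) := by
  refine ⟨smoothFunctions_ext fun p => ?_, smoothFunctions_ext fun p => ?_,
    smoothFunctions_ext fun p => ?_, smoothFunctions_ext fun p => ?_⟩ <;>
  · simp only [wirtinger_apply, conjFun_apply, dx, dy, du, dv, dirDeriv_conjFun]
    simp only [map_mul, map_add, map_sub, map_div₀, map_one, map_ofNat, Complex.conj_I]
    ring

/-! ### Coordinates and automorphy factors -/

/-- The constant function `c`. -/
noncomputable abbrev constFun (c : ℂ) : smoothFunctions := algebraMap ℂ smoothFunctions c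

theorem constFun_apply (c : ℂ) (p : ℍ × ℂ) : (constFun c : ℍ × ℂ → ℂ) p = c := rfl

theorem mul_apply (f g : smoothFunctions) (p : ℍ × ℂ) :
    ((f * g : smoothFunctions) : ℍ × ℂ → ℂ) p = (f : ℍ × ℂ → ℂ) p * (g : ℍ × ℂ → ℂ) p := rfl

theorem add_apply (f g : smoothFunctions) (p : ℍ × ℂ) :
    ((f + g : smoothFunctions) : ℍ × ℂ → ℂ) p = (f : ℍ × ℂ → ℂ) p + (g : ℍ × ℂ → ℂ) p := rfl

theorem sub_apply (f g : smoothFunctions) (p : ℍ × ℂ) :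
    ((f - g : smoothFunctions) : ℍ × ℂ → ℂ) p = (f : ℍ × ℂ → ℂ) p - (g : ℍ × ℂ → ℂ) p := rfl

theorem zero_apply (p : ℍ × ℂ) : ((0 : smoothFunctions) : ℍ × ℂ → ℂ) p = 0 := rfl

/-- The reciprocal of a nowhere vanishing smooth function. -/
noncomputable def recip (f : smoothFunctions) (hf : ∀ p, (f : ℍ × ℂ → ℂ) p ≠ 0) :
    smoothFunctions :=
  ⟨fun p => ((f : ℍ × ℂ → ℂ) p)⁻¹,
    mem_smoothFunctions_of_eqOn (F := fun q => (extend f q)⁻¹)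
      (ContDiffOn.inv (mem_smoothFunctions.mp f.2) fun q hq => by
        rw [extend_of_mem _ hq]; exact hf _)
      fun p => by rw [extend_coe]⟩

theorem mul_recip (f : smoothFunctions) (hf : ∀ p, (f : ℍ × ℂ → ℂ) p ≠ 0) :
    f * recip f hf = 1 :=
  smoothFunctions_ext fun p => mul_inv_cancel₀ (hf p)

/-- The coordinate function `τ`. -/
noncomputable def coordTau : smoothFunctions :=
  ⟨fun p => (p.1 : ℂ), mem_smoothFunctions_of_eqOn (F := Prod.fst) contDiff_fst.contDiffOn
    fun _ => rfl⟩

/-- The coordinate function `z`. -/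
noncomputable def coordZ : smoothFunctions :=
  ⟨fun p => p.2, mem_smoothFunctions_of_eqOn (F := Prod.snd) contDiff_snd.contDiffOn
    fun _ => rfl⟩

theorem coordTau_apply (p : ℍ × ℂ) : (coordTau : ℍ × ℂ → ℂ) p = p.1 := rfl

theorem coordZ_apply (p : ℍ × ℂ) : (coordZ : ℍ × ℂ → ℂ) p = p.2 := rfl

theorem coordY_apply (p : ℍ × ℂ) : (coordY : ℍ × ℂ → ℂ) p = ((p.1 : ℂ).im : ℂ) := rfl

theorem wirtinger_coordTau :
    dtau coordTau = 1 ∧ dtauBar coordTau = 0 ∧ dz coordTau = 0 ∧ dzBar coordTau = 0 := by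
  have h (p : ℍ × ℂ) := wirtinger_of_holomorphic (f := coordTau) (p := p) (A := 1) (B := 0)
    (F := Prod.fst) (fun _ => rfl) (hasFDerivAt_fst.congr_fderiv (by ext <;> simp))
  exact ⟨smoothFunctions_ext fun p => (h p).1, smoothFunctions_ext fun p => (h p).2.1,
    smoothFunctions_ext fun p => (h p).2.2.1, smoothFunctions_ext fun p => (h p).2.2.2⟩

theorem wirtinger_coordZ :
    dtau coordZ = 0 ∧ dtauBar coordZ = 0 ∧ dz coordZ = 1 ∧ dzBar coordZ = 0 := by
  have h (p : ℍ × ℂ) := wirtinger_of_holomorphic (f := coordZ) (p := p) (A := 0) (B := 1)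
    (F := Prod.snd) (fun _ => rfl) (hasFDerivAt_snd.congr_fderiv (by ext <;> simp))
  exact ⟨smoothFunctions_ext fun p => (h p).1, smoothFunctions_ext fun p => (h p).2.1,
    smoothFunctions_ext fun p => (h p).2.2.1, smoothFunctions_ext fun p => (h p).2.2.2⟩

theorem conjFun_zero : conjFun 0 = 0 := smoothFunctions_ext fun _ => map_zero _

theorem conjFun_one : conjFun 1 = 1 := smoothFunctions_ext fun _ => map_one _

theorem wirtinger_conj_coordTau : dtau (conjFun coordTau) = 0 ∧ dtauBar (conjFun coordTau) = 1 ∧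
    dz (conjFun coordTau) = 0 ∧ dzBar (conjFun coordTau) = 0 := by
  obtain ⟨h1, h2, h3, h4⟩ := wirtinger_conjFun coordTau
  obtain ⟨k1, k2, k3, k4⟩ := wirtinger_coordTau
  simp [h1, h2, h3, h4, k1, k2, k3, k4, conjFun_zero, conjFun_one]

theorem wirtinger_conj_coordZ : dtau (conjFun coordZ) = 0 ∧ dtauBar (conjFun coordZ) = 0 ∧
    dz (conjFun coordZ) = 0 ∧ dzBar (conjFun coordZ) = 1 := by
  obtain ⟨h1, h2, h3, h4⟩ := wirtinger_conjFun coordZ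
  obtain ⟨k1, k2, k3, k4⟩ := wirtinger_coordZ
  simp [h1, h2, h3, h4, k1, k2, k3, k4, conjFun_zero, conjFun_one]

theorem coordY_eq : coordY = (-Complex.I / 2) • (coordTau - conjFun coordTau) := by
  refine smoothFunctions_ext fun p => ?_
  change (((p.1 : ℂ).im : ℝ) : ℂ) = -Complex.I / 2 * ((p.1 : ℂ) - starRingEnd ℂ (p.1 : ℂ))
  rw [Complex.sub_conj]
  push_cast
  linear_combination ((p.1 : ℂ).im : ℂ) * Complex.I_mul_I

theorem coordV_eq : coordV = (-Complex.I / 2) • (coordZ - conjFun coordZ) := by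
  refine smoothFunctions_ext fun p => ?_
  change ((p.2.im : ℝ) : ℂ) = -Complex.I / 2 * (p.2 - starRingEnd ℂ p.2)
  rw [Complex.sub_conj]
  push_cast
  linear_combination (p.2.im : ℂ) * Complex.I_mul_I

theorem wirtinger_coordY : dtau coordY = constFun (-Complex.I / 2) ∧
    dtauBar coordY = constFun (Complex.I / 2) ∧ dz coordY = 0 ∧ dzBar coordY = 0 := by
  obtain ⟨h1, h2, h3, h4⟩ := wirtinger_conj_coordTau
  obtain ⟨k1, k2, k3, k4⟩ := wirtinger_coordTau
  rw [coordY_eq]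
  simp only [map_smul, map_sub, h1, h2, h3, h4, k1, k2, k3, k4, constFun,
    Algebra.algebraMap_eq_smul_one, sub_zero, smul_zero, and_true, true_and, zero_sub]
  rw [smul_neg, ← neg_smul]
  congr 1
  ring

theorem wirtinger_coordV : dtau coordV = 0 ∧ dtauBar coordV = 0 ∧
    dz coordV = constFun (-Complex.I / 2) ∧ dzBar coordV = constFun (Complex.I / 2) := by
  obtain ⟨h1, h2, h3, h4⟩ := wirtinger_conj_coordZ
  obtain ⟨k1, k2, k3, k4⟩ := wirtinger_coordZ
  rw [coordV_eq]
  simp only [map_smul, map_sub, h1, h2, h3, h4, k1, k2, k3, k4, constFun,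
    Algebra.algebraMap_eq_smul_one, sub_zero, smul_zero, true_and, zero_sub]
  rw [smul_neg, ← neg_smul]
  congr 1
  ring

theorem coordY_ne_zero (p : ℍ × ℂ) : (coordY : ℍ × ℂ → ℂ) p ≠ 0 := by
  rw [coordY_apply]
  exact_mod_cast p.1.im_pos.ne'

/-- The real function `v / y`: writing `z = p τ + q` with `p`, `q` real, this is `p`. -/
noncomputable def coordP : smoothFunctions := coordV * recip coordY coordY_ne_zero

theorem coordY_mul_coordP : coordY * coordP = coordV := by
  rw [coordP, mul_left_comm, mul_recip, mul_one]

theorem coordP_apply (p : ℍ × ℂ) :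
    (coordP : ℍ × ℂ → ℂ) p = (p.2.im : ℂ) / ((p.1 : ℂ).im : ℂ) := rfl

theorem conjFun_coordP : conjFun coordP = coordP :=
  smoothFunctions_ext fun p => by rw [conjFun_apply, coordP_apply]; simp

/-- The derivative `∂/∂τ` at constant `p = v / y` and `q`, where `z = p τ + q`. It is
`∂/∂τ + (v / y) ∂/∂z`. -/
noncomputable def horiz : Module.End ℂ smoothFunctions := dtau + coordP • dz

/-- The complex conjugate of `horiz`. -/
noncomputable def horizBar : Module.End ℂ smoothFunctions := dtauBar + coordP • dzBar

theorem horiz_apply (f : smoothFunctions) : horiz f = dtau f + coordP * dz f := rfl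

theorem horizBar_apply (f : smoothFunctions) : horizBar f = dtauBar f + coordP * dzBar f := rfl

theorem wirtinger_mul (a b : smoothFunctions) :
    dtau (a * b) = a * dtau b + b * dtau a ∧ dtauBar (a * b) = a * dtauBar b + b * dtauBar a ∧
      dz (a * b) = a * dz b + b * dz a ∧ dzBar (a * b) = a * dzBar b + b * dzBar a :=
  ⟨wirtingerFrame.leibniz 0 a b, wirtingerFrame.leibniz 1 a b, wirtingerFrame.leibniz 2 a b,
    wirtingerFrame.leibniz 3 a b⟩

theorem wirtinger_constFun (c : ℂ) : dtau (constFun c) = 0 ∧ dtauBar (constFun c) = 0 ∧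
    dz (constFun c) = 0 ∧ dzBar (constFun c) = 0 :=
  ⟨wirtingerFrame.op_algebraMap 0 c, wirtingerFrame.op_algebraMap 1 c,
    wirtingerFrame.op_algebraMap 2 c, wirtingerFrame.op_algebraMap 3 c⟩

theorem wirtinger_inverse {a b : smoothFunctions} (h : a * b = 1) :
    dtau b = -b ^ 2 * dtau a ∧ dtauBar b = -b ^ 2 * dtauBar a ∧ dz b = -b ^ 2 * dz a ∧
      dzBar b = -b ^ 2 * dzBar a :=
  ⟨wirtingerFrame.op_inverse 0 h, wirtingerFrame.op_inverse 1 h, wirtingerFrame.op_inverse 2 h,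
    wirtingerFrame.op_inverse 3 h⟩

theorem horiz_mul (a b : smoothFunctions) : horiz (a * b) = a * horiz b + b * horiz a := by
  rw [horiz_apply, horiz_apply, horiz_apply, (wirtinger_mul a b).1, (wirtinger_mul a b).2.2.1]
  ring

theorem horiz_conjFun (f : smoothFunctions) : horiz (conjFun f) = conjFun (horizBar f) := by
  obtain ⟨h1, -, h3, -⟩ := wirtinger_conjFun f
  rw [horiz_apply, horizBar_apply, conjFun_add, conjFun_mul, conjFun_coordP, h1, h3]

/-- The function `p` is one of the two functions held constant by `horiz`. -/
theorem horiz_coordP : horiz coordP = 0 := by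
  have h := horiz_mul coordY coordP
  rw [coordY_mul_coordP, horiz_apply coordV, horiz_apply coordY, wirtinger_coordV.1,
    wirtinger_coordV.2.2.1, wirtinger_coordY.1, wirtinger_coordY.2.2.1] at h
  have h2 : coordY * horiz coordP = 0 := by linear_combination -h
  have h3 := mul_recip coordY coordY_ne_zero
  linear_combination recip coordY coordY_ne_zero * h2 - horiz coordP * h3

/-- The automorphy factor `c τ + d` of `g`. -/
noncomputable def autFun (g : JacobiGroup) : smoothFunctions :=
  constFun (g.mat 1 0 : ℂ) * coordTau + constFun (g.mat 1 1 : ℂ)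

/-- The function `(c τ + d)⁻¹`. -/
noncomputable def autInv (g : JacobiGroup) : smoothFunctions :=
  recip (autFun g) fun p => g.autFactor_ne_zero p.1.im_pos

theorem autFun_mul_autInv (g : JacobiGroup) : autFun g * autInv g = 1 := mul_recip _ _

theorem wirtinger_add (a b : smoothFunctions) :
    dtau (a + b) = dtau a + dtau b ∧ dtauBar (a + b) = dtauBar a + dtauBar b ∧
      dz (a + b) = dz a + dz b ∧ dzBar (a + b) = dzBar a + dzBar b :=
  ⟨map_add _ _ _, map_add _ _ _, map_add _ _ _, map_add _ _ _⟩

theorem wirtinger_autInv (g : JacobiGroup) :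
    dtau (autInv g) = -constFun (g.mat 1 0 : ℂ) * autInv g ^ 2 ∧ dtauBar (autInv g) = 0 ∧
      dz (autInv g) = 0 ∧ dzBar (autInv g) = 0 := by
  obtain ⟨h1, h2, h3, h4⟩ := wirtinger_inverse (autFun_mul_autInv g)
  rw [h1, h2, h3, h4, autFun]
  simp only [wirtinger_add, wirtinger_mul, wirtinger_constFun, wirtinger_coordTau]
  refine ⟨?_, ?_, ?_, ?_⟩ <;> ring

theorem det_mat (g : JacobiGroup) :
    (g.mat 0 0 : ℂ) * g.mat 1 1 - (g.mat 0 1 : ℂ) * g.mat 1 0 = 1 := by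
  exact_mod_cast JacobiGroup.det_eq g.mat

theorem pullback_apply (g : JacobiGroup) (f : smoothFunctions) (p : ℍ × ℂ) :
    (pullback g f : ℍ × ℂ → ℂ) p = (f : ℍ × ℂ → ℂ) (g • p) := rfl

theorem pullback_mul (g : JacobiGroup) (a b : smoothFunctions) :
    pullback g (a * b) = pullback g a * pullback g b := rfl

theorem pullback_conjFun (g : JacobiGroup) (f : smoothFunctions) :
    pullback g (conjFun f) = conjFun (pullback g f) := rfl

theorem pullback_coordTau (g : JacobiGroup) : pullback g coordTau =
    (constFun (g.mat 0 0 : ℂ) * coordTau + constFun (g.mat 0 1 : ℂ)) * autInv g := by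
  refine smoothFunctions_ext fun p => ?_
  rw [pullback_apply, coordTau_apply, JacobiGroup.smul_def, JacobiGroup.coe_mat_smul, div_eq_mul_inv]
  rfl

theorem pullback_coordZ (g : JacobiGroup) : pullback g coordZ =
    (coordZ + constFun (g.lam : ℂ) * coordTau + constFun (g.mu : ℂ)) * autInv g := by
  refine smoothFunctions_ext fun p => ?_
  rw [pullback_apply, coordZ_apply, JacobiGroup.smul_def, div_eq_mul_inv]
  rfl

theorem wirtinger_pullback_coordTau (g : JacobiGroup) :
    dtau (pullback g coordTau) = autInv g ^ 2 ∧ dtauBar (pullback g coordTau) = 0 ∧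
      dz (pullback g coordTau) = 0 ∧ dzBar (pullback g coordTau) = 0 := by
  rw [pullback_coordTau]
  simp only [wirtinger_add, wirtinger_mul, wirtinger_constFun, wirtinger_coordTau,
    wirtinger_autInv]
  refine ⟨?_, by ring, by ring, by ring⟩
  have h1 := autFun_mul_autInv g
  have h2 : constFun (g.mat 0 0 : ℂ) * constFun (g.mat 1 1 : ℂ)
      - constFun (g.mat 0 1 : ℂ) * constFun (g.mat 1 0 : ℂ) = 1 := by
    rw [← map_mul, ← map_mul, ← map_sub, det_mat, map_one]
  rw [autFun] at h1
  linear_combination (-constFun (g.mat 0 0 : ℂ) * autInv g) * h1 + autInv g ^ 2 * h2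

theorem wirtinger_pullback_coordZ (g : JacobiGroup) :
    dtau (pullback g coordZ) = constFun (g.lam : ℂ) * autInv g
        - constFun (g.mat 1 0 : ℂ) * autInv g * pullback g coordZ ∧
      dtauBar (pullback g coordZ) = 0 ∧
      dz (pullback g coordZ) = autInv g ∧ dzBar (pullback g coordZ) = 0 := by
  rw [pullback_coordZ]
  simp only [wirtinger_add, wirtinger_mul, wirtinger_constFun, wirtinger_coordTau,
    wirtinger_autInv, wirtinger_coordZ]
  refine ⟨?_, ?_, ?_, ?_⟩ <;> ring

/-! ### The chain rule for the action -/

/-- The chain rule, in terms of the components `τ ∘ g` and `z ∘ g` of the action of `g`. -/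
theorem dirDeriv_pullback (g : JacobiGroup) (w : ℂ × ℂ) (f : smoothFunctions) (p : ℍ × ℂ) :
    (dirDeriv w (pullback g f) : ℍ × ℂ → ℂ) p =
      fderiv ℝ (extend f) (((g • p).1 : ℂ), (g • p).2)
        ((dirDeriv w (pullback g coordTau) : ℍ × ℂ → ℂ) p,
          (dirDeriv w (pullback g coordZ) : ℍ × ℂ → ℂ) p) := by
  have h1 := (differentiableAt_extend (pullback g coordTau) p).hasFDerivAt
  have h2 := (differentiableAt_extend (pullback g coordZ) p).hasFDerivAt
  have h3 : HasFDerivAt (extend f) (fderiv ℝ (extend f) (((g • p).1 : ℂ), (g • p).2))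
      (extend (pullback g coordTau) ((p.1 : ℂ), p.2),
        extend (pullback g coordZ) ((p.1 : ℂ), p.2)) := by
    simp only [extend_coe]
    exact (differentiableAt_extend f (g • p)).hasFDerivAt
  have h4 := h3.comp ((p.1 : ℂ), p.2) (h1.prodMk h2)
  rw [dirDeriv_apply_of_hasFDerivAt (fun q => ?_) h4 w]
  · rfl
  · simp only [Function.comp_apply, extend_coe, pullback_apply, coordTau_apply, coordZ_apply]

/-- The chain rule for the holomorphic derivatives: as `g` acts holomorphically, no conjugate
derivatives occur, and as `τ ∘ g` does not depend on `z`, neither does `∂/∂τ` in the second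
formula. -/
theorem wirtinger_pullback (g : JacobiGroup) (f : smoothFunctions) :
    dtau (pullback g f) = dtau (pullback g coordTau) * pullback g (dtau f)
        + dtau (pullback g coordZ) * pullback g (dz f) ∧
      dz (pullback g f) = autInv g * pullback g (dz f) := by
  have hI : Complex.I * Complex.I = -1 := Complex.I_mul_I
  obtain ⟨-, a2, a3, a4⟩ := wirtinger_pullback_coordTau g
  obtain ⟨-, b2, b3, b4⟩ := wirtinger_pullback_coordZ g
  have key (α β : ℂ) (p : ℍ × ℂ) :
      fderiv ℝ (extend f) (((g • p).1 : ℂ), (g • p).2) (α, β)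
        - Complex.I * fderiv ℝ (extend f) (((g • p).1 : ℂ), (g • p).2)
          (Complex.I * α, Complex.I * β) =
      2 * (α * (pullback g (dtau f) : ℍ × ℂ → ℂ) p + β * (pullback g (dz f) : ℍ × ℂ → ℂ) p) := by
    simp only [dirDeriv_coord, pullback_apply, wirtinger_apply]
    simp only [Complex.mul_re, Complex.mul_im, Complex.I_re, Complex.I_im]
    push_cast
    linear_combination
      ((dx f : ℍ × ℂ → ℂ) (g • p) - Complex.I * (dy f : ℍ × ℂ → ℂ) (g • p)) * Complex.re_add_im α
      + ((du f : ℍ × ℂ → ℂ) (g • p) - Complex.I * (dv f : ℍ × ℂ → ℂ) (g • p)) * Complex.re_add_im β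
      + (α.im * (dy f : ℍ × ℂ → ℂ) (g • p) + β.im * (dv f : ℍ × ℂ → ℂ) (g • p)) * hI
  have hdy (h : smoothFunctions) (hh : dtauBar h = 0) : dx h = dtau h ∧
      dy h = constFun Complex.I * dtau h := by
    rw [dx_eq, dy_eq]
    simp [hh, Algebra.smul_def]
  have hdv (h : smoothFunctions) (hh : dzBar h = 0) : du h = dz h ∧
      dv h = constFun Complex.I * dz h := by
    rw [du_eq, dv_eq]
    simp [hh, Algebra.smul_def]
  constructor
  · refine smoothFunctions_ext fun p => ?_
    have e1 := dirDeriv_pullback g (1, 0) f p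
    have e2 := dirDeriv_pullback g (Complex.I, 0) f p
    simp only [← dx.eq_1, ← dy.eq_1, hdy _ a2, hdy _ b2, mul_apply, constFun_apply] at e1 e2
    rw [(wirtinger_apply _ p).1, e1, e2, key, add_apply, mul_apply, mul_apply]
    ring
  · refine smoothFunctions_ext fun p => ?_
    have e1 := dirDeriv_pullback g (0, 1) f p
    have e2 := dirDeriv_pullback g (0, Complex.I) f p
    simp only [← du.eq_1, ← dv.eq_1, hdv _ a4, hdv _ b4, mul_apply, constFun_apply] at e1 e2
    rw [(wirtinger_apply _ p).2.2.1, e1, e2, key, a3, b3, mul_apply, zero_apply]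
    ring

theorem pullback_coordY (g : JacobiGroup) :
    pullback g coordY = coordY * autInv g * conjFun (autInv g) := by
  have h : pullback g coordY = (-Complex.I / 2) •
      (pullback g coordTau - conjFun (pullback g coordTau)) := by
    rw [coordY_eq]; rfl
  rw [h, pullback_coordTau, coordY_eq]
  refine smoothFunctions_ext fun p => ?_
  have hJ := g.autFactor_ne_zero p.1.im_pos
  have hJ' := (map_ne_zero (starRingEnd ℂ)).mpr hJ
  change -Complex.I / 2 * (((g.mat 0 0 : ℂ) * p.1 + (g.mat 0 1 : ℂ)) * (g.autFactor p.1)⁻¹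
    - starRingEnd ℂ (((g.mat 0 0 : ℂ) * p.1 + (g.mat 0 1 : ℂ)) * (g.autFactor p.1)⁻¹)) =
    -Complex.I / 2 * ((p.1 : ℂ) - starRingEnd ℂ (p.1 : ℂ)) * (g.autFactor p.1)⁻¹ *
      starRingEnd ℂ ((g.autFactor p.1)⁻¹)
  rw [map_mul, map_inv₀]
  field_simp
  simp only [JacobiGroup.autFactor, map_add, map_mul, Complex.conj_ofReal]
  linear_combination (starRingEnd ℂ (p.1 : ℂ) - p.1) * det_mat g

/-- The coefficient of `∂/∂z` in `N (f ∘ g)`, where `N` is `horiz`, is `(c τ + d)⁻²` times the one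
in `(N f) ∘ g`. This is the transformation law of `p = v / y` under the Jacobi group. -/
theorem pullback_coordP (g : JacobiGroup) :
    dtau (pullback g coordZ) + coordP * autInv g = autInv g ^ 2 * pullback g coordP := by
  rw [(wirtinger_pullback_coordZ g).1, pullback_coordZ]
  have h1 : pullback g coordY * pullback g coordP = pullback g coordV := by
    rw [← pullback_mul, coordY_mul_coordP]
  have h2 : pullback g coordV = (-Complex.I / 2) •
      (pullback g coordZ - conjFun (pullback g coordZ)) := by
    rw [coordV_eq]; rfl
  rw [h2, pullback_coordZ, pullback_coordY] at h1
  refine smoothFunctions_ext fun p => ?_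
  have hy := coordY_ne_zero p
  have hyt : (coordY : ℍ × ℂ → ℂ) p = -Complex.I / 2 * (p.1 - starRingEnd ℂ (p.1 : ℂ)) := by
    rw [coordY_eq]; rfl
  have hvt : (coordV : ℍ × ℂ → ℂ) p = -Complex.I / 2 * (p.2 - starRingEnd ℂ p.2) := by
    rw [coordV_eq]; rfl
  have h3 : (coordY : ℍ × ℂ → ℂ) p * (coordP : ℍ × ℂ → ℂ) p = (coordV : ℍ × ℂ → ℂ) p :=
    congrArg (fun f : smoothFunctions => (f : ℍ × ℂ → ℂ) p) coordY_mul_coordP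
  have h4 : (coordY : ℍ × ℂ → ℂ) p * (g.autFactor p.1)⁻¹ * starRingEnd ℂ ((g.autFactor p.1)⁻¹) *
      (pullback g coordP : ℍ × ℂ → ℂ) p = -Complex.I / 2 *
      ((p.2 + (g.lam : ℂ) * p.1 + (g.mu : ℂ)) * (g.autFactor p.1)⁻¹
        - starRingEnd ℂ ((p.2 + (g.lam : ℂ) * p.1 + (g.mu : ℂ)) * (g.autFactor p.1)⁻¹)) :=
    congrArg (fun f : smoothFunctions => (f : ℍ × ℂ → ℂ) p) h1
  change (g.lam : ℂ) * (g.autFactor p.1)⁻¹ - (g.mat 1 0 : ℂ) * (g.autFactor p.1)⁻¹ *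
    ((p.2 + (g.lam : ℂ) * p.1 + (g.mu : ℂ)) * (g.autFactor p.1)⁻¹)
    + (coordP : ℍ × ℂ → ℂ) p * (g.autFactor p.1)⁻¹ =
    (g.autFactor p.1)⁻¹ ^ 2 * (pullback g coordP : ℍ × ℂ → ℂ) p
  have hJ := g.autFactor_ne_zero p.1.im_pos
  have hJ' := (map_ne_zero (starRingEnd ℂ)).mpr hJ
  rw [map_mul, map_inv₀] at h4
  refine mul_left_cancel₀ hy ?_
  have h5 : (coordY : ℍ × ℂ → ℂ) p * (pullback g coordP : ℍ × ℂ → ℂ) p = -Complex.I / 2 *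
      ((p.2 + (g.lam : ℂ) * p.1 + (g.mu : ℂ)) * starRingEnd ℂ (g.autFactor p.1)
        - starRingEnd ℂ (p.2 + (g.lam : ℂ) * p.1 + (g.mu : ℂ)) * g.autFactor p.1) := by
    field_simp at h4
    linear_combination (1 / 2 : ℂ) * h4
  have hs : starRingEnd ℂ (g.autFactor p.1)
      = (g.mat 1 0 : ℂ) * starRingEnd ℂ (p.1 : ℂ) + (g.mat 1 1 : ℂ) := by
    simp [JacobiGroup.autFactor]
  have hs' : g.autFactor p.1 = (g.mat 1 0 : ℂ) * p.1 + (g.mat 1 1 : ℂ) := rfl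
  simp only [map_add, map_mul, Complex.conj_ofReal] at h5
  field_simp
  refine mul_left_cancel₀ hy ?_
  linear_combination g.autFactor p.1 * h3 + g.autFactor p.1 * hvt
    + (g.lam * g.autFactor p.1 - g.mat 1 0 * (p.2 + g.lam * p.1 + g.mu)) * hyt - h5
    + Complex.I / 2 * (p.2 + g.lam * p.1 + g.mu) * hs
    - Complex.I / 2 * (p.2 + g.lam * p.1 + g.mu) * hs'

/-! ### Invariant operators -/

/-- The invariant operators form the centralizer of the pull-backs. -/
noncomputable def invariantOps : Subalgebra ℂ (Module.End ℂ smoothFunctions) :=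
  Subalgebra.centralizer ℂ (Set.range pullback)

theorem mem_invariantOps {P : Module.End ℂ smoothFunctions} :
    P ∈ invariantOps ↔ IsInvariant P := by
  rw [invariantOps, Subalgebra.mem_centralizer_iff, Set.forall_mem_range]
  exact ⟨fun h g f => (LinearMap.congr_fun (h g) f).symm,
    fun h g => LinearMap.ext fun f => (h g f).symm⟩

/-- `y² N N̄`, where `N` is `horiz`. -/
noncomputable def lapHoriz : Module.End ℂ smoothFunctions := coordY ^ 2 • (horiz * horizBar)

/-- `y ∂/∂z ∂/∂z̄`. -/
noncomputable def lapZ : Module.End ℂ smoothFunctions := coordY • (dz * dzBar)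

/-- `y² N (∂/∂z̄)²`, where `N` is `horiz`. -/
noncomputable def mixed : Module.End ℂ smoothFunctions := coordY ^ 2 • (horiz * dzBar ^ 2)

/-- The complex conjugate of `mixed`. -/
noncomputable def mixedBar : Module.End ℂ smoothFunctions := coordY ^ 2 • (horizBar * dz ^ 2)

theorem lapHoriz_apply (f : smoothFunctions) :
    lapHoriz f = coordY ^ 2 * horiz (horizBar f) := rfl

theorem lapZ_apply (f : smoothFunctions) : lapZ f = coordY * dz (dzBar f) := rfl

theorem mixed_apply (f : smoothFunctions) :
    mixed f = coordY ^ 2 * horiz (dzBar (dzBar f)) := rfl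

theorem mixedBar_apply (f : smoothFunctions) :
    mixedBar f = coordY ^ 2 * horizBar (dz (dz f)) := rfl

theorem dz_pullback (g : JacobiGroup) (f : smoothFunctions) :
    dz (pullback g f) = autInv g * pullback g (dz f) := (wirtinger_pullback g f).2

theorem horiz_pullback (g : JacobiGroup) (f : smoothFunctions) :
    horiz (pullback g f) = autInv g ^ 2 * pullback g (horiz f) := by
  have h := pullback_coordP g
  rw [horiz_apply, horiz_apply, map_add, pullback_mul, dz_pullback, (wirtinger_pullback g f).1,
    (wirtinger_pullback_coordTau g).1]
  linear_combination pullback g (dz f) * h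

theorem dzBar_pullback (g : JacobiGroup) (f : smoothFunctions) :
    dzBar (pullback g f) = conjFun (autInv g) * pullback g (dzBar f) := by
  have h := dz_pullback g (conjFun f)
  rw [pullback_conjFun, (wirtinger_conjFun _).2.2.1, (wirtinger_conjFun _).2.2.1,
    pullback_conjFun] at h
  rw [← conjFun_conjFun (dzBar _), h, conjFun_mul, conjFun_conjFun]

theorem horizBar_pullback (g : JacobiGroup) (f : smoothFunctions) :
    horizBar (pullback g f) = conjFun (autInv g) ^ 2 * pullback g (horizBar f) := by
  have h := horiz_pullback g (conjFun f)
  rw [pullback_conjFun, horiz_conjFun, horiz_conjFun, pullback_conjFun] at h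
  rw [← conjFun_conjFun (horizBar _), h, conjFun_mul, conjFun_conjFun, pow_two, conjFun_mul,
    pow_two]

theorem horiz_conj_autInv (g : JacobiGroup) : horiz (conjFun (autInv g)) = 0 := by
  obtain ⟨-, h2, -, h4⟩ := wirtinger_autInv g
  rw [horiz_conjFun, horizBar_apply, h2, h4, mul_zero, add_zero, conjFun_zero]

theorem horizBar_autInv (g : JacobiGroup) : horizBar (autInv g) = 0 := by
  obtain ⟨-, h2, -, h4⟩ := wirtinger_autInv g
  rw [horizBar_apply, h2, h4, mul_zero, add_zero]

theorem horizBar_mul (a b : smoothFunctions) :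
    horizBar (a * b) = a * horizBar b + b * horizBar a := by
  rw [horizBar_apply, horizBar_apply, horizBar_apply, (wirtinger_mul a b).2.1,
    (wirtinger_mul a b).2.2.2]
  ring

theorem dz_conj_autInv (g : JacobiGroup) : dz (conjFun (autInv g)) = 0 := by
  rw [(wirtinger_conjFun _).2.2.1, (wirtinger_autInv g).2.2.2, conjFun_zero]

theorem dzBar_conj_autInv (g : JacobiGroup) : dzBar (conjFun (autInv g)) = 0 := by
  rw [(wirtinger_conjFun _).2.2.2, (wirtinger_autInv g).2.2.1, conjFun_zero]

theorem lapHoriz_mem : lapHoriz ∈ invariantOps := by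
  refine mem_invariantOps.mpr fun g f => ?_
  rw [lapHoriz_apply, lapHoriz_apply, pullback_mul, horizBar_pullback, pow_two (conjFun _), mul_assoc,
    horiz_mul, horiz_mul, horiz_conj_autInv, horiz_pullback, pow_two coordY, pullback_mul,
    pullback_coordY]
  ring

theorem lapZ_mem : lapZ ∈ invariantOps := by
  refine mem_invariantOps.mpr fun g f => ?_
  rw [lapZ_apply, lapZ_apply, pullback_mul, dzBar_pullback, (wirtinger_mul _ _).2.2.1,
    dz_conj_autInv, dz_pullback, pullback_coordY]
  ring

theorem mixed_mem : mixed ∈ invariantOps := by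
  refine mem_invariantOps.mpr fun g f => ?_
  rw [mixed_apply, mixed_apply, pullback_mul, dzBar_pullback, (wirtinger_mul _ _).2.2.2,
    dzBar_conj_autInv, dzBar_pullback, mul_zero, add_zero, horiz_mul, horiz_mul,
    horiz_conj_autInv, horiz_pullback, pow_two coordY, pullback_mul, pullback_coordY]
  ring

theorem mixedBar_mem : mixedBar ∈ invariantOps := by
  refine mem_invariantOps.mpr fun g f => ?_
  rw [mixedBar_apply, mixedBar_apply, pullback_mul, dz_pullback, (wirtinger_mul _ _).2.2.1,
    (wirtinger_autInv g).2.2.1, dz_pullback, mul_zero, add_zero, horizBar_mul, horizBar_mul,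
    horizBar_autInv, horizBar_pullback, pow_two coordY, pullback_mul, pullback_coordY]
  ring

/-! ### The explicit operators in terms of Wirtinger derivatives -/

theorem wirtinger_comm (f : smoothFunctions) :
    dtauBar (dtau f) = dtau (dtauBar f) ∧ dz (dtau f) = dtau (dz f) ∧
    dz (dtauBar f) = dtauBar (dz f) ∧ dzBar (dtau f) = dtau (dzBar f) ∧
    dzBar (dtauBar f) = dtauBar (dzBar f) ∧ dzBar (dz f) = dz (dzBar f) :=
  ⟨LinearMap.congr_fun (wirtingerFrame.commute 1 0).eq f,
    LinearMap.congr_fun (wirtingerFrame.commute 2 0).eq f,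
    LinearMap.congr_fun (wirtingerFrame.commute 2 1).eq f,
    LinearMap.congr_fun (wirtingerFrame.commute 3 0).eq f,
    LinearMap.congr_fun (wirtingerFrame.commute 3 1).eq f,
    LinearMap.congr_fun (wirtingerFrame.commute 3 2).eq f⟩

theorem real_comm (f : smoothFunctions) :
    dy (dx f) = dx (dy f) ∧ du (dx f) = dx (du f) ∧ du (dy f) = dy (du f) ∧
    dv (dx f) = dx (dv f) ∧ dv (dy f) = dy (dv f) ∧ dv (du f) = du (dv f) :=
  ⟨LinearMap.congr_fun (dirDeriv_commute _ _).eq f,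
    LinearMap.congr_fun (dirDeriv_commute _ _).eq f,
    LinearMap.congr_fun (dirDeriv_commute _ _).eq f,
    LinearMap.congr_fun (dirDeriv_commute _ _).eq f,
    LinearMap.congr_fun (dirDeriv_commute _ _).eq f,
    LinearMap.congr_fun (dirDeriv_commute _ _).eq f⟩

theorem opD_apply (f : smoothFunctions) : opD f =
    coordY ^ 2 * (dx (dx f) + dy (dy f)) + coordV ^ 2 * (du (du f) + dv (dv f))
      + 2 * coordY * coordV * (dx (du f) + dy (dv f)) := rfl

theorem opPsi_apply (f : smoothFunctions) :
    opPsi f = coordY * (du (du f) + dv (dv f)) := rfl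

theorem opD1_apply (f : smoothFunctions) : opD1 f =
    2 * coordY ^ 2 * dx (du (dv f)) - coordY ^ 2 * dy (du (du f) - dv (dv f))
      + (coordV * dv (opPsi f) + opPsi f) := rfl

theorem opD2_apply (f : smoothFunctions) : opD2 f =
    coordY ^ 2 * dx (dv (dv f) - du (du f)) - 2 * coordY ^ 2 * dy (du (dv f))
      - coordV * du (opPsi f) := rfl

theorem constFun_I_mul_I : constFun Complex.I * constFun Complex.I = -1 := by
  rw [← map_mul, Complex.I_mul_I, map_neg, map_one]

theorem real_mul (a b : smoothFunctions) :
    dx (a * b) = a * dx b + b * dx a ∧ dy (a * b) = a * dy b + b * dy a ∧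
      du (a * b) = a * du b + b * du a ∧ dv (a * b) = a * dv b + b * dv a :=
  ⟨dirDeriv_mul _ a b, dirDeriv_mul _ a b, dirDeriv_mul _ a b, dirDeriv_mul _ a b⟩

theorem dx_apply (f : smoothFunctions) : dx f = dtau f + dtauBar f := by
  rw [dx_eq]; rfl

theorem dy_apply (f : smoothFunctions) : dy f = constFun Complex.I * (dtau f - dtauBar f) := by
  rw [dy_eq, ← Algebra.smul_def]; rfl

theorem du_apply (f : smoothFunctions) : du f = dz f + dzBar f := by
  rw [du_eq]; rfl

theorem dv_apply (f : smoothFunctions) : dv f = constFun Complex.I * (dz f - dzBar f) := by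
  rw [dv_eq, ← Algebra.smul_def]; rfl

theorem real_coordY : dx coordY = 0 ∧ dy coordY = 1 ∧ du coordY = 0 ∧ dv coordY = 0 := by
  simp only [dx_apply, dy_apply, du_apply, dv_apply, wirtinger_coordY]
  refine ⟨?_, ?_, by ring, by ring⟩
  · rw [← map_add, ← map_zero (algebraMap ℂ smoothFunctions)]
    congr 1; ring
  · rw [← map_sub, ← map_mul, ← map_one (algebraMap ℂ smoothFunctions)]
    congr 1; linear_combination -Complex.I_mul_I

theorem real_coordV : dx coordV = 0 ∧ dy coordV = 0 ∧ du coordV = 0 ∧ dv coordV = 1 := by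
  simp only [dx_apply, dy_apply, du_apply, dv_apply, wirtinger_coordV]
  refine ⟨by ring, by ring, ?_, ?_⟩
  · rw [← map_add, ← map_zero (algebraMap ℂ smoothFunctions)]
    congr 1; ring
  · rw [← map_sub, ← map_mul, ← map_one (algebraMap ℂ smoothFunctions)]
    congr 1; linear_combination -Complex.I_mul_I

theorem wirtinger_sub (a b : smoothFunctions) :
    dtau (a - b) = dtau a - dtau b ∧ dtauBar (a - b) = dtauBar a - dtauBar b ∧
      dz (a - b) = dz a - dz b ∧ dzBar (a - b) = dzBar a - dzBar b :=
  ⟨map_sub _ _ _, map_sub _ _ _, map_sub _ _ _, map_sub _ _ _⟩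

theorem opD_eq : opD = (4 : ℂ) • lapHoriz := by
  refine LinearMap.ext fun f => ?_
  have hI := constFun_I_mul_I
  have hp := coordY_mul_coordP
  have hN : horiz (horizBar f) = dtau (dtauBar f) + coordP * dz (dtauBar f)
      + coordP * (dtau (dzBar f) + coordP * dz (dzBar f)) := by
    rw [horizBar_apply, map_add, horiz_mul, horiz_coordP, horiz_apply, horiz_apply]
    ring
  rw [LinearMap.smul_apply, opD_apply, lapHoriz_apply, hN, ← hp, Algebra.smul_def]
  simp only [dx_apply, dy_apply, du_apply, dv_apply, wirtinger_add, wirtinger_sub, wirtinger_mul,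
    wirtinger_constFun, wirtinger_comm]
  rw [map_ofNat]
  linear_combination (coordY ^ 2 * (dtau (dtau f) - 2 * dtau (dtauBar f) + dtauBar (dtauBar f))
    + coordY ^ 2 * coordP ^ 2 * (dz (dz f) - 2 * dz (dzBar f) + dzBar (dzBar f))
    + 2 * coordY ^ 2 * coordP * (dtau (dz f) - dtau (dzBar f) - dtauBar (dz f)
      + dtauBar (dzBar f))) * hI

theorem opPsi_eq : opPsi = (4 : ℂ) • lapZ := by
  refine LinearMap.ext fun f => ?_
  have hI := constFun_I_mul_I
  rw [LinearMap.smul_apply, opPsi_apply, lapZ_apply, Algebra.smul_def]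
  simp only [du_apply, dv_apply, wirtinger_add, wirtinger_sub, wirtinger_mul,
    wirtinger_constFun, wirtinger_comm]
  rw [map_ofNat]
  linear_combination coordY * (dz (dz f) - 2 * dz (dzBar f) + dzBar (dzBar f)) * hI

theorem opPsi_apply_wirtinger (f : smoothFunctions) : opPsi f = 4 * (coordY * dz (dzBar f)) := by
  rw [opPsi_eq, LinearMap.smul_apply, Algebra.smul_def, map_ofNat]; rfl

theorem opD1_eq : opD1 = (4 : ℂ) • lapZ - (4 * Complex.I) • (mixed - mixedBar) := by
  refine LinearMap.ext fun f => ?_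
  have hI := constFun_I_mul_I
  have hp := coordY_mul_coordP
  change opD1 f = (4 : ℂ) • lapZ f - (4 * Complex.I) • (mixed f - mixedBar f)
  have h2 (n : ℕ) [n.AtLeastTwo] (a : smoothFunctions) : dv (ofNat(n) * a) = ofNat(n) * dv a := by
    rw [← Nat.cast_ofNat, ← nsmul_eq_mul, map_nsmul, nsmul_eq_mul]
  rw [opD1_apply, lapZ_apply, mixed_apply, mixedBar_apply, horiz_apply, horizBar_apply,
    Algebra.smul_def, Algebra.smul_def, map_mul, map_ofNat, opPsi_apply_wirtinger, h2, (real_mul _ _).2.2.2,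
    real_coordY.2.2.2, ← hp]
  simp only [dx_apply, dy_apply, du_apply, dv_apply, wirtinger_add, wirtinger_sub, wirtinger_mul,
    wirtinger_constFun, wirtinger_comm, map_zero]
  linear_combination coordY ^ 2 * constFun Complex.I *
    (dtau (dz (dz f)) - 2 * dtau (dz (dzBar f)) + dtau (dzBar (dzBar f))
      - dtauBar (dz (dz f)) + 2 * dtauBar (dz (dzBar f)) - dtauBar (dzBar (dzBar f))) * hI

theorem opD2_eq : opD2 = (-4 : ℂ) • (mixed + mixedBar) := by
  refine LinearMap.ext fun f => ?_
  have hI := constFun_I_mul_I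
  have hp := coordY_mul_coordP
  change opD2 f = (-4 : ℂ) • (mixed f + mixedBar f)
  have h2 (n : ℕ) [n.AtLeastTwo] (a : smoothFunctions) : du (ofNat(n) * a) = ofNat(n) * du a := by
    rw [← Nat.cast_ofNat, ← nsmul_eq_mul, map_nsmul, nsmul_eq_mul]
  rw [opD2_apply, mixed_apply, mixedBar_apply, horiz_apply, horizBar_apply,
    Algebra.smul_def, map_neg, map_ofNat, opPsi_apply_wirtinger, h2, (real_mul _ _).2.2.1,
    real_coordY.2.2.1, ← hp]
  simp only [dx_apply, dy_apply, du_apply, dv_apply, wirtinger_add, wirtinger_sub, wirtinger_mul,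
    wirtinger_constFun, wirtinger_comm, map_zero]
  linear_combination (coordY ^ 2 *
    (dtau (dz (dz f)) - 2 * dtau (dz (dzBar f)) + dtau (dzBar (dzBar f))
      + dtauBar (dz (dz f)) - 2 * dtauBar (dz (dzBar f)) + dtauBar (dzBar (dzBar f)))
    - 2 * coordY ^ 2 * (dtau (dz (dz f)) - dtau (dzBar (dzBar f)) - dtauBar (dz (dz f))
      + dtauBar (dzBar (dzBar f)))) * hI

theorem commutator_eq : opD * opPsi - opPsi * opD =
    mulOp (2 * coordY ^ 2) * (dy * (du ^ 2 - dv ^ 2))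
      - mulOp (4 * coordY ^ 2) * (dx * du * dv)
      - (2 : ℂ) • (mulOp coordV * dv * opPsi + opPsi) := by
  refine LinearMap.ext fun f => ?_
  change opD (opPsi f) - opPsi (opD f) = 2 * coordY ^ 2 * (dy (du (du f) - dv (dv f)))
    - 4 * coordY ^ 2 * dx (du (dv f)) - (2 : ℂ) • (coordV * dv (opPsi f) + opPsi f)
  rw [Algebra.smul_def, map_ofNat]
  have hs (a b : smoothFunctions) : dy (a - b) = dy a - dy b := map_sub _ _ _
  have ha (a b : smoothFunctions) : dx (a + b) = dx a + dx b ∧ dy (a + b) = dy a + dy b ∧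
      du (a + b) = du a + du b ∧ dv (a + b) = dv a + dv b :=
    ⟨map_add _ _ _, map_add _ _ _, map_add _ _ _, map_add _ _ _⟩
  have h0 : dx (0 : smoothFunctions) = 0 ∧ dy (0 : smoothFunctions) = 0 ∧
      du (0 : smoothFunctions) = 0 ∧ dv (0 : smoothFunctions) = 0 :=
    ⟨map_zero _, map_zero _, map_zero _, map_zero _⟩
  have h1 : dx (1 : smoothFunctions) = 0 ∧ dy (1 : smoothFunctions) = 0 ∧
      du (1 : smoothFunctions) = 0 ∧ dv (1 : smoothFunctions) = 0 :=
    ⟨realFrame.op_one 0, realFrame.op_one 1, realFrame.op_one 2, realFrame.op_one 3⟩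
  have h2 : (2 : smoothFunctions) = 1 + 1 := by ring
  simp only [opD_apply, opPsi_apply, pow_two, h2, real_mul, real_coordY, real_coordV, ha, hs, h0,
    h1, real_comm]
  ring

/-! ### Differential operators and the two frames -/

theorem realFrame_op_mem (i : Fin 4) : realFrame.op i ∈ wirtingerFrame.ops 2 := by
  have h (i : Fin 4) := wirtingerFrame.op_mem_ops i
  fin_cases i
  · change dx ∈ _; rw [dx_eq]; exact add_mem (h 0) (h 1)
  · change dy ∈ _; rw [dy_eq]; exact Frame.complex_smul_mem_ops (Frame.sub_mem_ops (h 0) (h 1)) _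
  · change du ∈ _; rw [du_eq]; exact add_mem (h 2) (h 3)
  · change dv ∈ _; rw [dv_eq]; exact Frame.complex_smul_mem_ops (Frame.sub_mem_ops (h 2) (h 3)) _

theorem wirtingerFrame_op_mem (i : Fin 4) : wirtingerFrame.op i ∈ realFrame.ops 2 := by
  have h (i : Fin 4) := realFrame.op_mem_ops i
  have hs (i : Fin 4) := Frame.complex_smul_mem_ops (h i) Complex.I
  fin_cases i
  · exact Frame.complex_smul_mem_ops (Frame.sub_mem_ops (h 0) (hs 1)) _
  · exact Frame.complex_smul_mem_ops (add_mem (h 0) (hs 1)) _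
  · exact Frame.complex_smul_mem_ops (Frame.sub_mem_ops (h 2) (hs 3)) _
  · exact Frame.complex_smul_mem_ops (add_mem (h 2) (hs 3)) _

theorem isDifferentialOperator_iff {P : Module.End ℂ smoothFunctions} :
    IsDifferentialOperator P ↔ ∃ n, P ∈ wirtingerFrame.ops n := by
  constructor
  · rintro ⟨s, a, rfl⟩
    refine wirtingerFrame.mem_ops_of_mem_span (Submodule.sum_mem _ fun α _ => ?_)
    refine Submodule.smul_mem _ (a α) ?_
    obtain ⟨n, hn⟩ := Frame.mono_mem_ops_of_op_mem realFrame_op_mem α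
    exact wirtingerFrame.ops_le_span n hn
  · rintro ⟨n, hn⟩
    obtain ⟨c, hc⟩ := (Finsupp.mem_span_range_iff_exists_finsupp).mp
      (Frame.ops_le_span_of_op_mem wirtingerFrame_op_mem n hn)
    exact ⟨c.support, c, hc.symm⟩

/-- The differential operators of all orders form a subalgebra. -/
noncomputable def diffOps : Subalgebra ℂ (Module.End ℂ smoothFunctions) where
  carrier := {P | ∃ n, P ∈ wirtingerFrame.ops n}
  mul_mem' := by
    rintro P Q ⟨m, hm⟩ ⟨n, hn⟩
    exact ⟨_, wirtingerFrame.mul_mem_ops (wirtingerFrame.ops_mono m.le_succ hm) hn⟩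
  add_mem' := by
    rintro P Q ⟨m, hm⟩ ⟨n, hn⟩
    exact ⟨max m n, add_mem (wirtingerFrame.ops_mono (le_max_left _ _) hm)
      (wirtingerFrame.ops_mono (le_max_right _ _) hn)⟩
  algebraMap_mem' c := by
    rw [Algebra.algebraMap_eq_smul_one]
    exact ⟨1, Frame.complex_smul_mem_ops (wirtingerFrame.one_mem_ops 0) c⟩

/-! ### The base point and its stabilizer -/

/-- The point `(i, 0)`. -/
noncomputable def basePoint : ℍ × ℂ := (UpperHalfPlane.I, 0)

/-- Evaluation at the base point. -/
noncomputable def evalBase : smoothFunctions →ₐ[ℂ] ℂ :=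
  (Pi.evalAlgHom ℂ (fun _ : ℍ × ℂ => ℂ) basePoint).comp smoothFunctions.val

theorem evalBase_apply (f : smoothFunctions) :
    evalBase f = (f : ℍ × ℂ → ℂ) basePoint := rfl

/-- The action is transitive: `(i, 0)` is moved to `(τ, z)` by the upper triangular matrix with
diagonal `√y, 1 / √y` sending `i` to `τ`, after a translation. -/
theorem exists_smul_basePoint (p : ℍ × ℂ) : ∃ g : JacobiGroup, g • basePoint = p := by
  obtain ⟨τ, z⟩ := p
  have hy : 0 < τ.im := τ.im_pos
  set s : ℝ := Real.sqrt τ.im with hs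
  have hs0 : s ≠ 0 := (Real.sqrt_pos.mpr hy).ne'
  have hss : s * s = τ.im := Real.mul_self_sqrt hy.le
  have hs0' : (s : ℂ) ≠ 0 := by exact_mod_cast hs0
  have hss' : (s : ℂ) * s = ((τ : ℂ).im : ℂ) := by exact_mod_cast hss
  let M : SL(2, ℝ) := ⟨!![s, τ.re / s; 0, 1 / s], by
    rw [Matrix.det_fin_two_of]; field_simp; ring⟩
  let g : JacobiGroup := ⟨M, z.im / s, z.re / s, 0⟩
  have hJ : g.autFactor UpperHalfPlane.I = (s : ℂ)⁻¹ := by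
    simp [JacobiGroup.autFactor, g, M]
  refine ⟨g, Prod.ext (UpperHalfPlane.ext ?_) ?_⟩
  · change ((g.mat • UpperHalfPlane.I : ℍ) : ℂ) = τ
    rw [JacobiGroup.coe_mat_smul, hJ]
    have h1 : ((g.mat 0 0 : ℝ) : ℂ) = s := rfl
    have h2 : ((g.mat 0 1 : ℝ) : ℂ) = (τ : ℂ).re / s := by
      rw [← Complex.ofReal_div]; rfl
    rw [h1, h2]
    field_simp
    rw [UpperHalfPlane.coe_I, pow_two, hss', mul_comm, add_comm, mul_comm Complex.I]
    exact Complex.re_add_im _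
  · change ((0 : ℂ) + (g.lam : ℂ) * (UpperHalfPlane.I : ℂ) + (g.mu : ℂ)) /
      g.autFactor UpperHalfPlane.I = z
    rw [hJ]
    simp only [g]
    push_cast
    field_simp
    rw [zero_mul, zero_add, add_comm]
    exact Complex.re_add_im _

/-- An invariant operator is determined by its value at the base point, as the action is
transitive. -/
theorem eq_zero_of_eval_eq_zero {P : Module.End ℂ smoothFunctions} (hP : P ∈ invariantOps)
    (h : ∀ f, evalBase (P f) = 0) : P = 0 := by
  refine LinearMap.ext fun f => smoothFunctions_ext fun p => ?_
  obtain ⟨g, rfl⟩ := exists_smul_basePoint p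
  have := h (pullback g f)
  rwa [mem_invariantOps.mp hP g f] at this

/-- The rotation by `θ` in `SL(2, ℝ)`, an element of the stabilizer of the base point. -/
noncomputable def rotation (θ : ℝ) : JacobiGroup where
  mat := ⟨!![Real.cos θ, Real.sin θ; -Real.sin θ, Real.cos θ], by
    rw [Matrix.det_fin_two_of]; linear_combination Real.sin_sq_add_cos_sq θ⟩
  lam := 0
  mu := 0
  kappa := 0

theorem coordTau_add_I_ne_zero (p : ℍ × ℂ) :
    ((coordTau + constFun Complex.I : smoothFunctions) : ℍ × ℂ → ℂ) p ≠ 0 := by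
  rw [add_apply, coordTau_apply, constFun_apply]
  intro h
  have h1 := congrArg Complex.im h
  simp at h1
  have := p.1.im_pos
  linarith

/-- The function `(τ + i)⁻¹`. -/
noncomputable def cayleyDenom : smoothFunctions :=
  recip (coordTau + constFun Complex.I) coordTau_add_I_ne_zero

/-- The holomorphic coordinate `2 i (τ - i) / (τ + i)`, multiplied by a constant of modulus one by
rotations. -/
noncomputable def discTau : smoothFunctions :=
  constFun (2 * Complex.I) * ((coordTau - constFun Complex.I) * cayleyDenom)

/-- The holomorphic coordinate `2 i z / (τ + i)`, multiplied by a constant of modulus one by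
rotations. -/
noncomputable def discZ : smoothFunctions := constFun (2 * Complex.I) * (coordZ * cayleyDenom)

/-- The disc coordinates and their conjugates: they vanish at the base point, are dual to the
Wirtinger frame there, and are eigenfunctions of the rotations. -/
noncomputable def discCoord : Fin 4 → smoothFunctions :=
  ![discTau, conjFun discTau, discZ, conjFun discZ]

theorem evalBase_discTau : evalBase discTau = 0 := by
  change 2 * Complex.I * ((((UpperHalfPlane.I : ℍ) : ℂ) - Complex.I) * _) = 0
  simp

theorem evalBase_discZ : evalBase discZ = 0 := by
  change 2 * Complex.I * ((0 : ℂ) * _) = 0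
  simp

theorem evalBase_conjFun (f : smoothFunctions) :
    evalBase (conjFun f) = starRingEnd ℂ (evalBase f) := rfl

theorem evalBase_discCoord (i : Fin 4) : evalBase (discCoord i) = 0 := by
  fin_cases i
  · exact evalBase_discTau
  · exact (evalBase_conjFun _).trans (by rw [evalBase_discTau, map_zero])
  · exact evalBase_discZ
  · exact (evalBase_conjFun _).trans (by rw [evalBase_discZ, map_zero])

theorem wirtinger_cayleyDenom :
    dtau cayleyDenom = -cayleyDenom ^ 2 ∧ dtauBar cayleyDenom = 0 ∧ dz cayleyDenom = 0 ∧
      dzBar cayleyDenom = 0 := by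
  have h := wirtinger_inverse (mul_recip _ coordTau_add_I_ne_zero)
  rw [← cayleyDenom] at h
  simpa [wirtinger_add, wirtinger_coordTau, wirtinger_constFun] using h

theorem evalBase_cayleyDenom : evalBase cayleyDenom = (2 * Complex.I)⁻¹ := by
  change (((UpperHalfPlane.I : ℍ) : ℂ) + Complex.I)⁻¹ = _
  rw [UpperHalfPlane.coe_I, two_mul]

theorem evalBase_wirtinger_discTau : evalBase (dtau discTau) = 1 ∧ dtauBar discTau = 0 ∧
    dz discTau = 0 ∧ dzBar discTau = 0 := by
  have h0 : evalBase (coordTau - constFun Complex.I) = 0 := by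
    change ((UpperHalfPlane.I : ℍ) : ℂ) - Complex.I = 0
    simp
  have h1 : (2 * Complex.I : ℂ) ≠ 0 := by simp
  rw [discTau]
  simp only [wirtinger_mul, wirtinger_sub, wirtinger_constFun, wirtinger_coordTau,
    wirtinger_cayleyDenom]
  refine ⟨?_, by ring, by ring, by ring⟩
  simp only [map_add, map_mul, map_neg, map_pow, h0, evalBase_cayleyDenom, map_sub, map_one,
    map_zero, constFun, AlgHom.commutes, Algebra.algebraMap_self, RingHom.id_apply]
  field_simp
  ring

theorem evalBase_wirtinger_discZ : evalBase (dtau discZ) = 0 ∧ dtauBar discZ = 0 ∧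
    evalBase (dz discZ) = 1 ∧ dzBar discZ = 0 := by
  have h0 : evalBase coordZ = 0 := rfl
  rw [discZ]
  simp only [wirtinger_mul, wirtinger_constFun, wirtinger_coordZ, wirtinger_cayleyDenom]
  refine ⟨?_, by ring, ?_, by ring⟩
  · simp [h0]
  · simp only [map_add, map_mul, h0, evalBase_cayleyDenom, map_one, map_zero, constFun, AlgHom.commutes, Algebra.algebraMap_self, RingHom.id_apply]
    field_simp
    ring

theorem evalBase_op_discCoord (i j : Fin 4) :
    evalBase (wirtingerFrame.op i (discCoord j)) = if i = j then 1 else 0 := by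
  obtain ⟨a1, a2, a3, a4⟩ := evalBase_wirtinger_discTau
  obtain ⟨b1, b2, b3, b4⟩ := evalBase_wirtinger_discZ
  obtain ⟨c1, c2, c3, c4⟩ := wirtinger_conjFun discTau
  obtain ⟨d1, d2, d3, d4⟩ := wirtinger_conjFun discZ
  fin_cases i <;> fin_cases j <;>
    simp [wirtingerFrame, discCoord, a1, a2, a3, a4, b1, b2, b3, b4, c1, c2, c3, c4, d1, d2, d3,
      d4, evalBase_conjFun]

theorem rotation_smul_basePoint (θ : ℝ) : rotation θ • basePoint = basePoint := by
  have hJ := (rotation θ).autFactor_ne_zero UpperHalfPlane.I.im_pos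
  refine Prod.ext (UpperHalfPlane.ext ?_) ?_
  · change (((rotation θ).mat • UpperHalfPlane.I : ℍ) : ℂ) = UpperHalfPlane.I
    rw [JacobiGroup.coe_mat_smul, div_eq_iff hJ]
    simp [JacobiGroup.autFactor, rotation]
    linear_combination (Complex.sin θ) * Complex.I_mul_I
  · change ((0 : ℂ) + ((0 : ℝ) : ℂ) * _ + ((0 : ℝ) : ℂ)) / _ = (0 : ℂ)
    simp

theorem pullback_rotation (θ : ℝ) :
    pullback (rotation θ) discTau = constFun (Complex.exp (θ * Complex.I) ^ 2) * discTau ∧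
      pullback (rotation θ) discZ = constFun (Complex.exp (θ * Complex.I)) * discZ := by
  have key (p : ℍ × ℂ) :
      ((p.1 : ℂ) * Complex.cos θ + Complex.sin θ - Complex.I * (rotation θ).autFactor p.1 =
        Complex.exp (θ * Complex.I) * (p.1 - Complex.I)) ∧
      (Complex.exp (θ * Complex.I) * ((p.1 : ℂ) * Complex.cos θ + Complex.sin θ
          + Complex.I * (rotation θ).autFactor p.1) = p.1 + Complex.I) := by
    have h1 : (rotation θ).autFactor p.1 = -Complex.sin θ * p.1 + Complex.cos θ := by
      simp [JacobiGroup.autFactor, rotation]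
    have h2 := Complex.sin_sq_add_cos_sq (θ : ℂ)
    rw [h1, Complex.exp_mul_I]
    constructor
    · linear_combination Complex.sin θ * Complex.I_mul_I
    · linear_combination (p.1 + Complex.I) * h2
        + (Complex.cos θ * Complex.sin θ - Complex.sin θ ^ 2 * p.1) * Complex.I_mul_I
  have hq : Complex.exp (θ * Complex.I) ≠ 0 := Complex.exp_ne_zero _
  have hsmul (p : ℍ × ℂ) : (((rotation θ • p).1 : ℍ) : ℂ) =
      ((p.1 : ℂ) * Complex.cos θ + Complex.sin θ) / (rotation θ).autFactor p.1 := by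
    rw [JacobiGroup.smul_def, JacobiGroup.coe_mat_smul]
    simp [rotation, mul_comm]
  have hden (p : ℍ × ℂ) : (cayleyDenom : ℍ × ℂ → ℂ) (rotation θ • p) =
      Complex.exp (θ * Complex.I) * (rotation θ).autFactor p.1 *
        (cayleyDenom : ℍ × ℂ → ℂ) p := by
    have hJ := (rotation θ).autFactor_ne_zero p.1.im_pos
    have h0 : (p.1 : ℂ) + Complex.I ≠ 0 := coordTau_add_I_ne_zero p
    change ((((rotation θ • p).1 : ℍ) : ℂ) + Complex.I)⁻¹ = _ * ((p.1 : ℂ) + Complex.I)⁻¹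
    rw [hsmul, ← (key p).2]
    rw [← (key p).2] at h0
    have h1 := right_ne_zero_of_mul h0
    rw [div_add' _ _ _ hJ]
    field_simp
  constructor
  · refine smoothFunctions_ext fun p => ?_
    have hJ := (rotation θ).autFactor_ne_zero p.1.im_pos
    change 2 * Complex.I * (((((rotation θ • p).1 : ℍ) : ℂ) - Complex.I) *
      (cayleyDenom : ℍ × ℂ → ℂ) (rotation θ • p)) = Complex.exp (θ * Complex.I) ^ 2 *
      (2 * Complex.I * (((p.1 : ℂ) - Complex.I) * (cayleyDenom : ℍ × ℂ → ℂ) p))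
    rw [hden, hsmul, div_sub' hJ, mul_comm ((rotation θ).autFactor p.1) Complex.I,
      (key p).1]
    field_simp
  · refine smoothFunctions_ext fun p => ?_
    have hJ := (rotation θ).autFactor_ne_zero p.1.im_pos
    change 2 * Complex.I * ((p.2 + ((0 : ℝ) : ℂ) * (p.1 : ℂ) + ((0 : ℝ) : ℂ)) /
      (rotation θ).autFactor p.1 * (cayleyDenom : ℍ × ℂ → ℂ) (rotation θ • p)) =
      Complex.exp (θ * Complex.I) * (2 * Complex.I * (p.2 * (cayleyDenom : ℍ × ℂ → ℂ) p))
    rw [hden]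
    push_cast
    field_simp
    ring

/-- The multi-indices of weight zero under rotations. -/
def weightZero : Set (Fin 4 → ℕ) := {β | 2 * β 0 + β 2 = 2 * β 1 + β 3}

theorem pullback_rotation_testFun (θ : ℝ) (β : Fin 4 → ℕ) :
    pullback (rotation θ) (Frame.testFun discCoord β) =
      Complex.exp (θ * Complex.I * ((2 * β 0 + β 2 : ℂ) - (2 * β 1 + β 3))) •
        Frame.testFun discCoord β := by
  obtain ⟨h1, h2⟩ := pullback_rotation θ
  refine smoothFunctions_ext fun p => ?_
  have e1 := congrArg (fun f : smoothFunctions => (f : ℍ × ℂ → ℂ) p) h1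
  have e2 := congrArg (fun f : smoothFunctions => (f : ℍ × ℂ → ℂ) p) h2
  simp only [pullback_apply, mul_apply, constFun_apply] at e1 e2
  have ht (q : ℍ × ℂ) : ((Frame.testFun discCoord β : smoothFunctions) : ℍ × ℂ → ℂ) q =
      (discTau : ℍ × ℂ → ℂ) q ^ β 0 * starRingEnd ℂ ((discTau : ℍ × ℂ → ℂ) q) ^ β 1 *
        (discZ : ℍ × ℂ → ℂ) q ^ β 2 * starRingEnd ℂ ((discZ : ℍ × ℂ → ℂ) q) ^ β 3 := by
    rw [Frame.testFun, Fin.prod_univ_four]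
    rfl
  change _ = Complex.exp _ * ((Frame.testFun discCoord β : smoothFunctions) : ℍ × ℂ → ℂ) p
  have hc : starRingEnd ℂ (Complex.exp (θ * Complex.I)) = Complex.exp (-(θ * Complex.I)) := by
    rw [← Complex.exp_conj]
    simp
  rw [pullback_apply, ht, ht, e1, e2]
  simp only [map_mul, map_pow, hc, mul_pow, ← pow_mul]
  rw [show (θ * Complex.I * ((2 * β 0 + β 2 : ℂ) - (2 * β 1 + β 3))) =
    ((2 * β 0 : ℕ) : ℂ) * (θ * Complex.I) + ((2 * β 1 : ℕ) : ℂ) * -(θ * Complex.I)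
      + (β 2 : ℂ) * (θ * Complex.I) + (β 3 : ℂ) * -(θ * Complex.I) by push_cast; ring,
    Complex.exp_add, Complex.exp_add, Complex.exp_add]
  simp only [Complex.exp_nat_mul]
  ring

/-- Rotations fix the base point and act on a test function by a scalar, which is not always `1`
if the weight is nonzero; so an invariant operator annihilates such a test function there. -/
theorem eval_testFun_eq_zero {P : Module.End ℂ smoothFunctions} (hP : P ∈ invariantOps)
    {β : Fin 4 → ℕ} (hβ : β ∉ weightZero) : evalBase (P (Frame.testFun discCoord β)) = 0 := by
  have hk : ((2 * β 0 + β 2 : ℝ) - (2 * β 1 + β 3)) ≠ 0 := by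
    rw [sub_ne_zero]
    exact_mod_cast hβ
  set k : ℝ := (2 * β 0 + β 2 : ℝ) - (2 * β 1 + β 3) with hkdef
  -- the rotation by `π / k` multiplies the test function of weight `k` by `-1`
  have h1 := pullback_rotation_testFun (Real.pi / k) β
  have h2 : (((Real.pi / k : ℝ) : ℂ) * Complex.I * ((2 * β 0 + β 2 : ℂ) - (2 * β 1 + β 3))) =
      Real.pi * Complex.I := by
    have hk' : (k : ℂ) ≠ 0 := by exact_mod_cast hk
    have : ((2 * β 0 + β 2 : ℂ) - (2 * β 1 + β 3)) = k := by rw [hkdef]; push_cast; ring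
    rw [this]
    push_cast
    field_simp
  rw [h2, Complex.exp_pi_mul_I] at h1
  have h3 := mem_invariantOps.mp hP (rotation (Real.pi / k)) (Frame.testFun discCoord β)
  rw [h1, map_smul] at h3
  have h4 := congrArg evalBase h3
  rw [map_smul, evalBase_apply (pullback _ _), pullback_apply, rotation_smul_basePoint,
    ← evalBase_apply, smul_eq_mul] at h4
  linear_combination (-1 / 2 : ℂ) * h4

/-! ### Generators -/

theorem hasLeading_horiz : wirtingerFrame.HasLeading evalBase horiz (Pi.single 0 1) :=
  (Frame.hasLeading_op 0).add_smul (by simp [evalBase_apply, coordP_apply, basePoint])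
    (by rw [Frame.deg_single]; exact wirtingerFrame.op_mem_ops 2)

theorem hasLeading_horizBar : wirtingerFrame.HasLeading evalBase horizBar (Pi.single 1 1) :=
  (Frame.hasLeading_op 1).add_smul (by simp [evalBase_apply, coordP_apply, basePoint])
    (by rw [Frame.deg_single]; exact wirtingerFrame.op_mem_ops 3)

theorem evalBase_coordY : evalBase coordY = 1 := by
  simp [evalBase_apply, coordY_apply, basePoint]

theorem hasLeading_lapHoriz :
    wirtingerFrame.HasLeading evalBase lapHoriz (Pi.single 0 1 + Pi.single 1 1) :=
  (hasLeading_horiz.mul hasLeading_horizBar).smul (by rw [map_pow, evalBase_coordY, one_pow])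

theorem hasLeading_lapZ :
    wirtingerFrame.HasLeading evalBase lapZ (Pi.single 2 1 + Pi.single 3 1) :=
  (Frame.HasLeading.mul (Frame.hasLeading_op 2) (Frame.hasLeading_op 3)).smul evalBase_coordY

theorem hasLeading_mixed :
    wirtingerFrame.HasLeading evalBase mixed (Pi.single 0 1 + 2 • Pi.single 3 1) :=
  (hasLeading_horiz.mul ((Frame.hasLeading_op 3).pow 2)).smul
    (by rw [map_pow, evalBase_coordY, one_pow])

theorem hasLeading_mixedBar :
    wirtingerFrame.HasLeading evalBase mixedBar (Pi.single 1 1 + 2 • Pi.single 2 1) :=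
  (hasLeading_horizBar.mul ((Frame.hasLeading_op 2).pow 2)).smul
    (by rw [map_pow, evalBase_coordY, one_pow])

/-- The subalgebra generated by `D`, `Ψ`, `D₁` and `D₂`. -/
noncomputable def generated : Subalgebra ℂ (Module.End ℂ smoothFunctions) :=
  Algebra.adjoin ℂ {opD, opPsi, opD1, opD2}

/-- The relations `opD_eq`, `opPsi_eq`, `opD1_eq` and `opD2_eq` can be inverted. -/
theorem generated_mem :
    lapHoriz ∈ generated ∧ lapZ ∈ generated ∧ mixed ∈ generated ∧ mixedBar ∈ generated := by
  have hD : opD ∈ generated := Algebra.subset_adjoin (by simp)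
  have hPsi : opPsi ∈ generated := Algebra.subset_adjoin (by simp)
  have hD1 : opD1 ∈ generated := Algebra.subset_adjoin (by simp)
  have hD2 : opD2 ∈ generated := Algebra.subset_adjoin (by simp)
  have e1 : lapHoriz = (1 / 4 : ℂ) • opD := by rw [opD_eq]; module
  have e2 : lapZ = (1 / 4 : ℂ) • opPsi := by rw [opPsi_eq]; module
  have hI : Complex.I * Complex.I = -1 := Complex.I_mul_I
  have e3 : mixed = (-1 / 8 : ℂ) • opD2 + (Complex.I / 8) • opD1 + (-Complex.I / 8) • opPsi := by
    rw [opD1_eq, opD2_eq, opPsi_eq]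
    match_scalars
    · linear_combination (1 / 2 : ℂ) * hI
    · linear_combination (-1 / 2 : ℂ) * hI
    · ring
  have e4 : mixedBar = (-1 / 8 : ℂ) • opD2 + (-Complex.I / 8) • opD1 + (Complex.I / 8) • opPsi := by
    rw [opD1_eq, opD2_eq, opPsi_eq]
    match_scalars
    · linear_combination (1 / 2 : ℂ) * hI
    · linear_combination (-1 / 2 : ℂ) * hI
    · ring
  have hs {P : Module.End ℂ smoothFunctions} (h : P ∈ generated) (c : ℂ) : c • P ∈ generated :=
    generated.smul_mem h c
  refine ⟨?_, ?_, ?_, ?_⟩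
  · rw [e1]; exact hs hD _
  · rw [e2]; exact hs hPsi _
  · rw [e3]; exact add_mem (add_mem (hs hD2 _) (hs hD1 _)) (hs hPsi _)
  · rw [e4]; exact add_mem (add_mem (hs hD2 _) (hs hD1 _)) (hs hPsi _)

/-- The monomials of weight zero are the products of powers of `∂_τ ∂_τ̄`, `∂_z ∂_z̄`, `∂_τ ∂_z̄²`
and `∂_τ̄ ∂_z²`, which are the leading terms of the four invariant operators. -/
theorem exists_hasLeading {α : Fin 4 → ℕ} (hα : α ∈ weightZero) :
    ∃ P ∈ generated, wirtingerFrame.HasLeading evalBase P α := by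
  obtain ⟨h1, h2, h3, h4⟩ := generated_mem
  have hα' : 2 * α 0 + α 2 = 2 * α 1 + α 3 := hα
  rcases le_total (α 1) (α 0) with h | h
  · refine ⟨lapHoriz ^ α 1 * lapZ ^ α 2 * mixed ^ (α 0 - α 1),
      mul_mem (mul_mem (pow_mem h1 _) (pow_mem h2 _)) (pow_mem h3 _), ?_⟩
    convert ((hasLeading_lapHoriz.pow (α 1)).mul (hasLeading_lapZ.pow (α 2))).mul
      (hasLeading_mixed.pow (α 0 - α 1)) using 1
    ext i
    fin_cases i <;> simp <;> omega
  · refine ⟨lapHoriz ^ α 0 * lapZ ^ α 3 * mixedBar ^ (α 1 - α 0),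
      mul_mem (mul_mem (pow_mem h1 _) (pow_mem h2 _)) (pow_mem h4 _), ?_⟩
    convert ((hasLeading_lapHoriz.pow (α 0)).mul (hasLeading_lapZ.pow (α 3))).mul
      (hasLeading_mixedBar.pow (α 1 - α 0)) using 1
    ext i
    fin_cases i <;> simp <;> omega

theorem generated_le_invariantOps : generated ≤ invariantOps := by
  refine Algebra.adjoin_le ?_
  have hs {P : Module.End ℂ smoothFunctions} (h : P ∈ invariantOps) (c : ℂ) :
    c • P ∈ invariantOps := invariantOps.smul_mem h c
  rintro P (rfl | rfl | rfl | rfl)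
  · rw [opD_eq]; exact hs lapHoriz_mem _
  · rw [opPsi_eq]; exact hs lapZ_mem _
  · rw [opD1_eq]
    exact sub_mem_subalgebra (hs lapZ_mem _) (hs (sub_mem_subalgebra mixed_mem mixedBar_mem) _)
  · rw [opD2_eq]
    exact hs (add_mem mixed_mem mixedBar_mem) _

theorem generated_le_diffOps : generated ≤ diffOps := by
  refine Algebra.adjoin_le ?_
  have hs {P : Module.End ℂ smoothFunctions} (h : P ∈ diffOps) (c : ℂ) :
    c • P ∈ diffOps := diffOps.smul_mem h c
  have h1 : lapHoriz ∈ diffOps := ⟨_, hasLeading_lapHoriz.mem_ops⟩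
  have h2 : lapZ ∈ diffOps := ⟨_, hasLeading_lapZ.mem_ops⟩
  have h3 : mixed ∈ diffOps := ⟨_, hasLeading_mixed.mem_ops⟩
  have h4 : mixedBar ∈ diffOps := ⟨_, hasLeading_mixedBar.mem_ops⟩
  rintro P (rfl | rfl | rfl | rfl)
  · rw [opD_eq]; exact hs h1 _
  · rw [opPsi_eq]; exact hs h2 _
  · rw [opD1_eq]
    exact sub_mem_subalgebra (hs h2 _) (hs (sub_mem_subalgebra h3 h4) _)
  · rw [opD2_eq]
    exact hs (add_mem h3 h4) _

theorem generated_eq : (generated : Set (Module.End ℂ smoothFunctions)) = invariantDiffOps := by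
  ext P
  constructor
  · exact fun h => ⟨isDifferentialOperator_iff.mpr (generated_le_diffOps h),
      mem_invariantOps.mp (generated_le_invariantOps h)⟩
  · rintro ⟨hdiff, hinv⟩
    obtain ⟨n, hn⟩ := isDifferentialOperator_iff.mp hdiff
    exact wirtingerFrame.mem_of_leading evalBase generated (Subalgebra.toSubmodule invariantOps)
      (fun P hP => generated_le_invariantOps hP) (fun P hP => eq_zero_of_eval_eq_zero hP)
      evalBase_discCoord evalBase_op_discCoord weightZero
      (fun P hP β hβ => eval_testFun_eq_zero hP hβ) (fun α hα => exists_hasLeading hα)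
      (mem_invariantOps.mpr hinv) hn fun _ => rfl

end SiegelJacobi

theorem theorem4 :
    ((Algebra.adjoin ℂ
        ({SiegelJacobi.opD, SiegelJacobi.opPsi, SiegelJacobi.opD1, SiegelJacobi.opD2} :
          Set (Module.End ℂ SiegelJacobi.smoothFunctions)) :
        Subalgebra ℂ (Module.End ℂ SiegelJacobi.smoothFunctions)) :
      Set (Module.End ℂ SiegelJacobi.smoothFunctions)) = SiegelJacobi.invariantDiffOps ∧
    SiegelJacobi.opD * SiegelJacobi.opPsi - SiegelJacobi.opPsi * SiegelJacobi.opD =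
      SiegelJacobi.mulOp (2 * SiegelJacobi.coordY ^ 2) *
          (SiegelJacobi.dy * (SiegelJacobi.du ^ 2 - SiegelJacobi.dv ^ 2))
        - SiegelJacobi.mulOp (4 * SiegelJacobi.coordY ^ 2) *
          (SiegelJacobi.dx * SiegelJacobi.du * SiegelJacobi.dv)
        - (2 : ℂ) • (SiegelJacobi.mulOp SiegelJacobi.coordV * SiegelJacobi.dv * SiegelJacobi.opPsi
          + SiegelJacobi.opPsi) := by
  exact ⟨SiegelJacobi.generated_eq, SiegelJacobi.commutator_eq⟩
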